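/- Let $\mathbb{G}=(\mathbb R^n,\circ,\{\delta_R\}_{R>0})$ be a homogeneous Carnot group: $\circ$ is a Lie group law on $\mathbb R^n$ with unit $0$, the dilations $\delta_R(x)=(R^{w_1}x_1,\dots,R^{w_n}x_n)$, with integer weights $w_i\ge 1$, are group automorphisms, and the left-invariant vector fields $X_j$ with $X_j(0)=\partial_j$, $w_j=1$, generate a Lie algebra that has rank $n$ at every point. Let $r$ be a symmetric homogeneous norm on $\mathbb{G}$, i.e. $r:\mathbb{G}\to\mathbb R$ is continuous, $r(x)>0$ iff $x\ne 0$, $r(\delta_R x)=R\,r(x)$ and $r(x^{-1})=r(x)$. A function $u$ is Lipschitz on a set $U$ if $|u(x)-u(y)|\le C\,r(x^{-1}\circ y)$ on $U$ for some constant $C$; $\mathrm{Lip}_{\mathrm{loc}}(\mathbb{G})$ is the set of functions that are Lipschitz on a neighbourhood of each point. For such $u$, let $\nabla_0u=(X_ju)_{w_j=1}$ be the weak horizontal gradient, with $|\cdot|$ and $\langle\cdot,\cdot\rangle$ Euclidean, and let $dx$ be the Lebesgue measure. Let $p>1$ and let $\varphi\in C^0([0,+\infty))$ satisfy $\varphi(0)=0$,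 $\varphi>0$ on $(0,+\infty)$, and $\varphi(t)\le Ct^{p-1}$ on $(0,+\infty)$ for some constant $C>0$. Let $\mu,\omega,\chi\in\mathbb R$ satisfy $$0\le\chi\le p-1,\qquad \mu<p-\chi,\qquad \omega>p-\chi-1 .$$ Then, for every $\gamma\ge 0$ and $K>0$, there is no non-constant $u\in\mathrm{Lip}_{\mathrm{loc}}(\mathbb{G})$ for which $\Omega_\gamma=\{x\in\mathbb{G}: u(x)>\gamma\}$ is non-empty and $u$ is a weak solution of $$\Delta^\varphi_{\mathbb{G}}u\ \ge\ K(1+r)^{-\mu}\,u^{\omega}\,\frac{\varphi(|\nabla_0u|)}{|\nabla_0u|^{p-1-\chi}}\qquad\text{on }\Omega_\gamma,$$ that is, for which $$\int_{\Omega_\gamma}\frac{\varphi(|\nabla_0u|)}{|\nabla_0u|}\langle\nabla_0u,\nabla_0\psi\rangle\,dx\ \le\ -\int_{\Omega_\gamma}K(1+r)^{-\mu}u^\omega\,\frac{\varphi(|\nabla_0u|)}{|\nabla_0u|^{p-1-\chi}}\,\psi\,dx$$ for every Lipschitz function $\psi\ge 0$ with compact support contained in $\Omega_\gamma$. Here $\frac{\varphi(|\nabla_0u|)}{|\nabla_0u|}\nabla_0u$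 and $\frac{\varphi(|\nabla_0u|)}{|\nabla_0u|^{p-1-\chi}}$ are taken to be $0$ where $\nabla_0u=0$. -/

import Mathlib

open MeasureTheory Set

/-- A Lie group structure on `ℝⁿ` (with unit the origin) for which the anisotropic dilations
`δ_R x = (R ^ wᵢ xᵢ)ᵢ`, with positive integer weights `wᵢ`, are automorphisms. The coordinates of
weight `j` are the `j`-th layer. -/
structure HomogeneousGroup (n : ℕ) where
  /-- the weight of each coordinate, i.e. the number of the layer that it belongs to -/
  weight : Fin n → ℕ
  weight_pos : ∀ i, 1 ≤ weight i
  /-- the group law `x ∘ y` -/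
  mul : (Fin n → ℝ) → (Fin n → ℝ) → (Fin n → ℝ)
  /-- the group inverse `x⁻¹` -/
  inv : (Fin n → ℝ) → (Fin n → ℝ)
  mul_assoc : ∀ x y z, mul (mul x y) z = mul x (mul y z)
  zero_mul : ∀ x, mul 0 x = x
  mul_zero : ∀ x, mul x 0 = x
  inv_mul : ∀ x, mul (inv x) x = 0
  contDiff_mul : ContDiff ℝ ((⊤ : ℕ∞) : WithTop ℕ∞) (fun q : (Fin n → ℝ) × (Fin n → ℝ) => mul q.1 q.2)
  contDiff_inv : ContDiff ℝ ((⊤ : ℕ∞) : WithTop ℕ∞) inv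
  dilation_mul : ∀ R : ℝ, 0 < R → ∀ x y : Fin n → ℝ,
    (fun i => R ^ weight i * mul x y i) =
      mul (fun i => R ^ weight i * x i) (fun i => R ^ weight i * y i)

namespace HomogeneousGroup

variable {n : ℕ} (G : HomogeneousGroup n)

/-- The dilation `δ_R`. -/
def dilation (R : ℝ) (x : Fin n → ℝ) : Fin n → ℝ := fun i => R ^ G.weight i * x i

/-- The left-invariant vector field that equals `∂ᵢ` at the origin: its value at `x` is the image
of `∂ᵢ` under the differential at the origin of the left translation by `x`. -/
noncomputable def leftField (i : Fin n) (x : Fin n → ℝ) : Fin n → ℝ :=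
  fderiv ℝ (G.mul x) 0 (Pi.single i 1)

/-- The iterated Lie brackets of the left-invariant vector fields `X_j`, `j` in the first layer
(the fields themselves included). They span the Lie algebra generated by the first layer. -/
inductive IsIteratedBracket : ((Fin n → ℝ) → (Fin n → ℝ)) → Prop
  | field (i : Fin n) (hi : G.weight i = 1) : IsIteratedBracket (G.leftField i)
  | bracket (V W : (Fin n → ℝ) → (Fin n → ℝ)) (hV : IsIteratedBracket V)
      (hW : IsIteratedBracket W) : IsIteratedBracket (VectorField.lieBracket ℝ V W)

/-- The first layer: the coordinates of weight one. -/
abbrev Horizontal : Type := {i : Fin n // G.weight i = 1}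

/-- A symmetric homogeneous norm on the group. -/
structure IsHomogeneousNorm (r : (Fin n → ℝ) → ℝ) : Prop where
  continuous : Continuous r
  pos_iff : ∀ x, 0 < r x ↔ x ≠ 0
  dilation : ∀ R : ℝ, 0 < R → ∀ x, r (G.dilation R x) = R * r x
  symm : ∀ x, r (G.inv x) = r x

/-- `u` is Lipschitz on `U` with respect to the homogeneous norm `r`. -/
def IsLipOn (r : (Fin n → ℝ) → ℝ) (u : (Fin n → ℝ) → ℝ) (U : Set (Fin n → ℝ)) : Prop :=
  ∃ C : ℝ, 0 < C ∧ ∀ x ∈ U, ∀ y ∈ U, |u x - u y| ≤ C * r (G.mul (G.inv x) y)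

/-- `u ∈ Lip_loc(𝔾)`. -/
def IsLocLip (r : (Fin n → ℝ) → ℝ) (u : (Fin n → ℝ) → ℝ) : Prop :=
  ∀ x, ∃ U ∈ nhds x, G.IsLipOn r u U

/-- `g` is the weak (distributional) horizontal gradient `∇₀u = (X_j u)_j`, `j` in the first layer:
`g` is locally integrable and `∫ u X_j ψ = - ∫ g_j ψ` for all `ψ ∈ C_c^∞`. (The fields `X_j` are
formally skew-adjoint with respect to the Lebesgue measure.) The metric on the first layer that
makes `(X_j)_j` orthonormal is the Euclidean one on the components. -/
def IsWeakHorizontalGradient (u : (Fin n → ℝ) → ℝ)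
    (g : (Fin n → ℝ) → EuclideanSpace ℝ G.Horizontal) : Prop :=
  LocallyIntegrable g ∧
    ∀ ψ : (Fin n → ℝ) → ℝ, ContDiff ℝ ((⊤ : ℕ∞) : WithTop ℕ∞) ψ → HasCompactSupport ψ → ∀ j : G.Horizontal,
      ∫ x, u x * fderiv ℝ ψ x (G.leftField j.1 x) = - ∫ x, g x j * ψ x

/-- `u` is a weak solution of `Δ^φ_𝔾 u ≥ b(x) f(u) l(|∇₀u|)` on the open set `Ω`: for all
nonnegative Lipschitz `ψ` with compact support in `Ω`,
`∫_Ω φ(|∇₀u|) / |∇₀u| ⟨∇₀u, ∇₀ψ⟩ ≤ - ∫_Ω b f(u) l(|∇₀u|) ψ`. -/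
def IsWeakSolutionOn (r : (Fin n → ℝ) → ℝ) (φ : ℝ → ℝ) (Ω : Set (Fin n → ℝ))
    (b : (Fin n → ℝ) → ℝ) (f l : ℝ → ℝ) (u : (Fin n → ℝ) → ℝ) : Prop :=
  ∃ g : (Fin n → ℝ) → EuclideanSpace ℝ G.Horizontal, G.IsWeakHorizontalGradient u g ∧
    ∀ ψ : (Fin n → ℝ) → ℝ, G.IsLipOn r ψ univ → HasCompactSupport ψ → tsupport ψ ⊆ Ω →
      (∀ x, 0 ≤ ψ x) →
      ∀ h : (Fin n → ℝ) → EuclideanSpace ℝ G.Horizontal, G.IsWeakHorizontalGradient ψ h →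
        ∫ x in Ω, φ ‖g x‖ / ‖g x‖ * inner ℝ (g x) (h x) ≤
          - ∫ x in Ω, b x * f (u x) * l ‖g x‖ * ψ x

end HomogeneousGroup

/-- A homogeneous Carnot group: a homogeneous group on `ℝⁿ` whose first-layer left-invariant
vector fields generate a Lie algebra of full rank at each point. -/
structure HomogeneousCarnotGroup (n : ℕ) extends HomogeneousGroup n where
  generated : ∀ x : Fin n → ℝ,
    Submodule.span ℝ {v | ∃ V, toHomogeneousGroup.IsIteratedBracket V ∧ V x = v} = ⊤

/-- The condition (WpC), weak `p`-coercivity of the `φ`-Laplacian. -/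
structure WeaklyCoercive (φ : ℝ → ℝ) (p : ℝ) : Prop where
  continuousOn : ContinuousOn φ (Ici 0)
  zero : φ 0 = 0
  pos : ∀ t, 0 < t → 0 < φ t
  bound : ∃ C : ℝ, 0 < C ∧ ∀ t, 0 < t → φ t ≤ C * t ^ (p - 1)

open Filter Topology

namespace HomogeneousGroup

variable {n : ℕ} (G : HomogeneousGroup n)

/-! ### Algebra of the group law and of the dilations -/

/-! The argument is a Caccioppoli-type energy estimate followed by a rigidity statement. Let `g` be
the weak horizontal gradient and W = (u - γ - ε)₊. The inequality is tested with ψ = W^α ζ^m, where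
ζ is a cutoff that equals 1 on the ball of radius R and satisfies |∇₀ζ| ≤ C/R. Besides the energy ∫
φ(|g|)|g| W^(α-1) ζ^m and the term coming from the right-hand side, this produces only a cross term
of size φ(|g|) W^α ζ^(m-1) / R. A three-term Young inequality (`young_three`,
`integrand_lower_bound`) absorbs it into the two others, at the price of an error that contains
neither u nor g. This works because each φ-term is φ(|g|)/|g|^(p-1), a factor bounded by a constant,
times a power of |g|; no lower growth bound on φ is needed.

Integrated over the support of ζ, the error is at most a constant times R^(D - m(1 - μ⁺b)), where
R^D bounds the growth of the volume and b < 1/(p - χ) is the Young weight of the right-hand side.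
Since μ < p - χ, a large m makes this a negative power of R; since ω > p - χ - 1, a large m also
makes α ≥ 2 (`exists_exponents`). Letting R → ∞ in `exists_energy_le` gives g = 0 almost everywhere
on {u > γ + ε} (`ae_eq_zero_of_energy_le`).

Hence the continuous function W^α has zero weak horizontal gradient and is constant, by the
bracket-generating condition (`eq_of_isWeakHorizontalGradient_zero`). If γ + ε lies below a value of
u, the constant is positive, so u itself is constant.

The gradient is only distributional, so the calculus for ψ must be derived. Right translations
preserve Lebesgue measure, so difference quotients along the first layer converge weakly to `g`; the
chain rule and the local bound on `g` follow from this. -/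

lemma inv_mul_cancel_left (x y : Fin n → ℝ) : G.mul (G.inv x) (G.mul x y) = y := by
  rw [← G.mul_assoc, G.inv_mul, G.zero_mul]

lemma mul_inv_self (x : Fin n → ℝ) : G.mul x (G.inv x) = 0 := by
  have h := G.inv_mul_cancel_left (G.inv x) (G.mul x (G.inv x))
  rw [G.inv_mul_cancel_left x, G.inv_mul] at h
  exact h.symm

lemma mul_inv_cancel_left (x y : Fin n → ℝ) : G.mul x (G.mul (G.inv x) y) = y := by
  rw [← G.mul_assoc, G.mul_inv_self, G.zero_mul]

lemma mul_inv_cancel_right (x y : Fin n → ℝ) : G.mul (G.mul x y) (G.inv y) = x := by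
  rw [G.mul_assoc, G.mul_inv_self, G.mul_zero]

lemma inv_mul_cancel_right (x y : Fin n → ℝ) : G.mul (G.mul x (G.inv y)) y = x := by
  rw [G.mul_assoc, G.inv_mul, G.mul_zero]

lemma eq_inv_of_mul_eq_zero {x y : Fin n → ℝ} (h : G.mul x y = 0) : y = G.inv x := by
  rw [← G.inv_mul_cancel_left x y, h, G.mul_zero]

lemma inv_mul_rev (x y : Fin n → ℝ) :
    G.inv (G.mul x y) = G.mul (G.inv y) (G.inv x) := by
  refine (G.eq_inv_of_mul_eq_zero ?_).symm
  rw [G.mul_assoc, G.mul_inv_cancel_left, G.mul_inv_self]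

lemma inv_inv (x : Fin n → ℝ) : G.inv (G.inv x) = x :=
  (G.eq_inv_of_mul_eq_zero (G.inv_mul x)).symm

lemma inv_zero : G.inv 0 = 0 := (G.eq_inv_of_mul_eq_zero (G.mul_zero 0)).symm

lemma continuous_mul : Continuous fun q : (Fin n → ℝ) × (Fin n → ℝ) => G.mul q.1 q.2 :=
  G.contDiff_mul.continuous

lemma continuous_inv : Continuous G.inv := G.contDiff_inv.continuous

lemma contDiff_mul_left (x : Fin n → ℝ) :
    ContDiff ℝ ((⊤ : ℕ∞) : WithTop ℕ∞) (G.mul x) :=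
  G.contDiff_mul.comp (contDiff_const.prodMk contDiff_id)

lemma contDiff_mul_right (y : Fin n → ℝ) :
    ContDiff ℝ ((⊤ : ℕ∞) : WithTop ℕ∞) (fun x => G.mul x y) :=
  G.contDiff_mul.comp (contDiff_id.prodMk contDiff_const)

/-- The right translation by `y` as a homeomorphism. -/
def rightTranslation (y : Fin n → ℝ) : (Fin n → ℝ) ≃ₜ (Fin n → ℝ) where
  toFun x := G.mul x y
  invFun x := G.mul x (G.inv y)
  left_inv x := G.mul_inv_cancel_right x y
  right_inv x := G.inv_mul_cancel_right x y
  continuous_toFun := (G.contDiff_mul_right y).continuous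
  continuous_invFun := (G.contDiff_mul_right _).continuous

/-- The dilation `δ_R` as a continuous linear map. -/
noncomputable def dilationL (R : ℝ) : (Fin n → ℝ) →L[ℝ] (Fin n → ℝ) :=
  ContinuousLinearMap.pi fun i => R ^ G.weight i • ContinuousLinearMap.proj (R := ℝ) i

lemma dilationL_apply (R : ℝ) (x : Fin n → ℝ) : G.dilationL R x = G.dilation R x := rfl

lemma dilation_apply (R : ℝ) (x : Fin n → ℝ) (i : Fin n) :
    G.dilation R x i = R ^ G.weight i * x i := rfl

lemma dilation_mul' {R : ℝ} (hR : 0 < R) (x y : Fin n → ℝ) :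
    G.dilation R (G.mul x y) = G.mul (G.dilation R x) (G.dilation R y) :=
  G.dilation_mul R hR x y

lemma dilation_dilation (R S : ℝ) (x : Fin n → ℝ) :
    G.dilation R (G.dilation S x) = G.dilation (R * S) x := by
  ext i
  simp only [dilation_apply, mul_pow, _root_.mul_assoc]

lemma dilation_one (x : Fin n → ℝ) : G.dilation 1 x = x := by
  ext i
  simp [dilation_apply]

lemma dilation_zero (R : ℝ) : G.dilation R 0 = 0 := by
  ext i
  simp [dilation_apply]

lemma zero_dilation (x : Fin n → ℝ) : G.dilation 0 x = 0 := by
  ext i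
  have := G.weight_pos i
  simp [dilation_apply, zero_pow (by omega : G.weight i ≠ 0)]

lemma continuous_dilation_left (x : Fin n → ℝ) : Continuous fun R => G.dilation R x :=
  continuous_pi fun _ => (continuous_id.pow _).mul continuous_const

lemma continuous_dilation (R : ℝ) : Continuous (G.dilation R) := (G.dilationL R).continuous

lemma dilation_single (R t : ℝ) {i : Fin n} (hi : G.weight i = 1) :
    G.dilation R (Pi.single i t) = Pi.single i (R * t) := by
  ext k
  by_cases hk : k = i
  · subst hk; simp [dilation_apply, hi]
  · simp [dilation_apply, hk]

lemma norm_dilation_le {R : ℝ} (hR₀ : 0 ≤ R) (hR : R ≤ 1) (x : Fin n → ℝ) :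
    ‖G.dilation R x‖ ≤ R * ‖x‖ := by
  refine (pi_norm_le_iff_of_nonneg (by positivity)).2 fun i => ?_
  rw [dilation_apply, norm_mul, norm_pow, Real.norm_of_nonneg hR₀]
  have : R ^ G.weight i ≤ R := pow_le_of_le_one hR₀ hR (by have := G.weight_pos i; omega)
  gcongr
  exact norm_le_pi_norm x i

lemma le_norm_dilation {R : ℝ} (hR : 1 ≤ R) (x : Fin n → ℝ) :
    R * ‖x‖ ≤ ‖G.dilation R x‖ := by
  have hR₀ : 0 < R := by linarith
  have h := G.norm_dilation_le (inv_nonneg.2 hR₀.le) (inv_le_one_of_one_le₀ hR) (G.dilation R x)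
  rw [dilation_dilation, inv_mul_cancel₀ hR₀.ne', dilation_one] at h
  rwa [← le_inv_mul_iff₀ hR₀]

lemma norm_dilation_le_pow {R : ℝ} (hR : 1 ≤ R) (x : Fin n → ℝ) :
    ‖G.dilation R x‖ ≤ R ^ (∑ i, G.weight i) * ‖x‖ := by
  refine (pi_norm_le_iff_of_nonneg (by positivity)).2 fun i => ?_
  rw [dilation_apply, norm_mul, norm_pow, Real.norm_of_nonneg (by linarith)]
  have : R ^ G.weight i ≤ R ^ (∑ i, G.weight i) :=
    pow_le_pow_right₀ hR (Finset.single_le_sum (fun _ _ => Nat.zero_le _) (Finset.mem_univ i))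
  gcongr
  exact norm_le_pi_norm x i

/-! ### Invariance of the Lebesgue measure -/

lemma hasFDerivAt_mul_right (x y : Fin n → ℝ) :
    HasFDerivAt (fun z => G.mul z y) (fderiv ℝ (fun z => G.mul z y) x) x :=
  ((G.contDiff_mul_right y).differentiable (by simp)).differentiableAt.hasFDerivAt

/-- Differentiate the automorphism identity: δ_R intertwines the right translations by y and by δ_R
y, and its nonzero determinant cancels. -/
lemma det_fderiv_mul_right_dilation {R : ℝ} (hR : 0 < R) (x y : Fin n → ℝ) :
    (fderiv ℝ (fun z => G.mul z (G.dilation R y)) (G.dilation R x)).det =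
      (fderiv ℝ (fun z => G.mul z y) x).det := by
  have h₁ : HasFDerivAt (fun z => G.mul (G.dilation R z) (G.dilation R y))
      ((fderiv ℝ (fun z => G.mul z (G.dilation R y)) (G.dilation R x)).comp (G.dilationL R)) x :=
    (G.hasFDerivAt_mul_right (G.dilation R x) (G.dilation R y)).comp x
      (G.dilationL R).hasFDerivAt
  have h₂ : HasFDerivAt (fun z => G.mul (G.dilation R z) (G.dilation R y))
      ((G.dilationL R).comp (fderiv ℝ (fun z => G.mul z y) x)) x := by
    simp_rw [← G.dilation_mul' hR]
    exact (G.dilationL R).hasFDerivAt.comp x (G.hasFDerivAt_mul_right x y)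
  have h := congrArg ContinuousLinearMap.det (h₁.unique h₂)
  have hinv : (G.dilationL R⁻¹).comp (G.dilationL R) = ContinuousLinearMap.id ℝ _ := by
    ext1 z
    simp [dilationL_apply, dilation_dilation, inv_mul_cancel₀ hR.ne', dilation_one]
  have hdet : (G.dilationL R).det ≠ 0 := by
    intro h0
    have := congrArg ContinuousLinearMap.det hinv
    simp only [ContinuousLinearMap.det, ContinuousLinearMap.toLinearMap_comp,
      LinearMap.det_comp, ContinuousLinearMap.coe_id, LinearMap.det_id] at this h0
    rw [h0] at this
    simp at this
  simp only [ContinuousLinearMap.det, ContinuousLinearMap.toLinearMap_comp,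
    LinearMap.det_comp] at h hdet ⊢
  rw [_root_.mul_comm] at h
  exact mul_left_cancel₀ hdet h

/-- The Jacobian is invariant under simultaneous dilation of both points, so let R → 0: the limit is
the Jacobian of translation by the unit, the identity map. -/
lemma det_fderiv_mul_right (x y : Fin n → ℝ) :
    (fderiv ℝ (fun z => G.mul z y) x).det = 1 := by
  have hc : Continuous fun q : (Fin n → ℝ) × (Fin n → ℝ) =>
      (fderiv ℝ (fun z => G.mul z q.2) q.1).det := by
    refine ContinuousLinearMap.continuous_det.comp ?_
    have : ContDiff ℝ 1 (Function.uncurry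
        fun (q : (Fin n → ℝ) × (Fin n → ℝ)) (z : Fin n → ℝ) => G.mul z q.2) :=
      (G.contDiff_mul.of_le (by exact_mod_cast le_top)).comp
        (contDiff_snd.prodMk (contDiff_snd.comp contDiff_fst))
    exact (ContDiff.fderiv (n := 0) (m := 1) this contDiff_fst (by norm_num)).continuous
  have hlim : Tendsto (fun R : ℝ => (fderiv ℝ (fun z => G.mul z (G.dilation R y))
      (G.dilation R x)).det) (𝓝[>] 0) (𝓝 (fderiv ℝ (fun z => G.mul z 0) 0).det) := by
    have h := (hc.comp ((G.continuous_dilation_left x).prodMk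
      (G.continuous_dilation_left y))).tendsto 0
    simp only [Function.comp_def, zero_dilation] at h
    exact h.mono_left nhdsWithin_le_nhds
  have hconst : Tendsto (fun R : ℝ => (fderiv ℝ (fun z => G.mul z (G.dilation R y))
      (G.dilation R x)).det) (𝓝[>] 0) (𝓝 (fderiv ℝ (fun z => G.mul z y) x).det) := by
    refine tendsto_const_nhds.congr' ?_
    filter_upwards [self_mem_nhdsWithin] with R hR
    exact (G.det_fderiv_mul_right_dilation hR x y).symm
  rw [tendsto_nhds_unique hconst hlim]
  simp [G.mul_zero, ContinuousLinearMap.det]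

lemma measurePreserving_mul_right (y : Fin n → ℝ) :
    MeasurePreserving (fun x => G.mul x y) volume volume := by
  refine ⟨(G.contDiff_mul_right y).continuous.measurable, ?_⟩
  ext s hs
  rw [Measure.map_apply (G.contDiff_mul_right y).continuous.measurable hs]
  have himg : (fun x => G.mul x y) '' ((fun x => G.mul x y) ⁻¹' s) = s :=
    image_preimage_eq s (G.rightTranslation y).surjective
  have h := lintegral_abs_det_fderiv_eq_addHaar_image volume
    ((G.contDiff_mul_right y).continuous.measurable hs)
    (fun x _ => (G.hasFDerivAt_mul_right x y).hasFDerivWithinAt)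
    ((G.rightTranslation y).injective.injOn)
  rw [himg] at h
  simpa [det_fderiv_mul_right] using h

lemma integral_mul_right {F : Type*} [NormedAddCommGroup F] [NormedSpace ℝ F]
    (f : (Fin n → ℝ) → F) (y : Fin n → ℝ) : ∫ x, f (G.mul x y) = ∫ x, f x :=
  (G.measurePreserving_mul_right y).integral_comp
    (G.rightTranslation y).measurableEmbedding f

end HomogeneousGroup

namespace HomogeneousGroup

variable {n : ℕ} {G : HomogeneousGroup n} {r : (Fin n → ℝ) → ℝ}

/-! ### Homogeneous norms -/

namespace IsHomogeneousNorm

lemma map_zero (hr : G.IsHomogeneousNorm r) : r 0 = 0 := by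
  have h := hr.dilation 2 two_pos 0
  rw [G.dilation_zero] at h
  linarith

lemma nonneg (hr : G.IsHomogeneousNorm r) (x : Fin n → ℝ) : 0 ≤ r x := by
  rcases eq_or_ne x 0 with rfl | hx
  · exact hr.map_zero.ge
  · exact ((hr.pos_iff x).2 hx).le

/-- Some δ_R with 0 < R ≤ 1 carries x onto the unit sphere, where r has a positive minimum; undoing
the dilation only increases r. -/
lemma exists_le_of_one_le_norm (hr : G.IsHomogeneousNorm r) :
    ∃ c : ℝ, 0 < c ∧ ∀ x, 1 ≤ ‖x‖ → c ≤ r x := by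
  obtain ⟨c, hc, hcS⟩ : ∃ c : ℝ, 0 < c ∧ ∀ x ∈ Metric.sphere (0 : Fin n → ℝ) 1, c ≤ r x := by
    rcases (Metric.sphere (0 : Fin n → ℝ) 1).eq_empty_or_nonempty with h | h
    -- The sphere is empty when n = 0.
    · exact ⟨1, one_pos, by simp [h]⟩
    · obtain ⟨x, hx, hmin⟩ := (isCompact_sphere (0 : Fin n → ℝ) 1).exists_isMinOn h
        hr.continuous.continuousOn
      refine ⟨r x, (hr.pos_iff x).2 ?_, fun y hy => hmin hy⟩
      rintro rfl
      simp at hx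
  refine ⟨c, hc, fun x hx => ?_⟩
  have hcont : ContinuousOn (fun R => ‖G.dilation R x‖) (Icc 0 1) :=
    (G.continuous_dilation_left x).norm.continuousOn
  obtain ⟨R, ⟨hR₀, hR₁⟩, hR⟩ := intermediate_value_Icc zero_le_one hcont
    (show (1 : ℝ) ∈ Icc _ _ by simp [G.zero_dilation, G.dilation_one, hx])
  have hRpos : 0 < R := by
    refine hR₀.lt_of_ne ?_
    rintro rfl
    simp [G.zero_dilation] at hR
  have h := hcS (G.dilation R x) (by simpa using hR)
  rw [hr.dilation R hRpos] at h
  have := hr.nonneg x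
  nlinarith

/-- All weights are at least 1, so dilation by ‖x‖⁻¹ ≥ 1 pushes x out of the open unit ball, where r
is bounded below. -/
lemma exists_mul_norm_le (hr : G.IsHomogeneousNorm r) :
    ∃ c : ℝ, 0 < c ∧ ∀ x, ‖x‖ ≤ 1 → c * ‖x‖ ≤ r x := by
  obtain ⟨c, hc, h⟩ := hr.exists_le_of_one_le_norm
  refine ⟨c, hc, fun x hx => ?_⟩
  rcases eq_or_ne x 0 with rfl | hx0
  · simp [hr.map_zero]
  have hpos : 0 < ‖x‖ := norm_pos_iff.2 hx0
  have h1 := h (G.dilation ‖x‖⁻¹ x)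
    (by simpa [inv_mul_cancel₀ hpos.ne'] using G.le_norm_dilation ((one_le_inv₀ hpos).2 hx) x)
  rw [hr.dilation _ (inv_pos.2 hpos), le_inv_mul_iff₀ hpos] at h1
  linarith

/-- Dilation by c / 2 makes r smaller than c, which forces the image into the unit ball. -/
lemma isCompact_le_one (hr : G.IsHomogeneousNorm r) : IsCompact {x | r x ≤ 1} := by
  obtain ⟨c, hc, h⟩ := hr.exists_le_of_one_le_norm
  have h2 : 0 < c / 2 := by positivity
  refine ((isCompact_closedBall (0 : Fin n → ℝ) 1).image
    (G.continuous_dilation (c / 2)⁻¹)).of_isClosed_subset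
    (isClosed_le hr.continuous continuous_const) fun x hx => ⟨G.dilation (c / 2) x, ?_, ?_⟩
  · by_contra hball
    have h1 := h (G.dilation (c / 2) x) (by
      rw [mem_closedBall_zero_iff, not_le] at hball
      exact hball.le)
    rw [hr.dilation _ h2] at h1
    have hx1 : r x ≤ 1 := hx
    nlinarith
  · rw [G.dilation_dilation, inv_mul_cancel₀ h2.ne', G.dilation_one]

end IsHomogeneousNorm

/-! ### Locally Lipschitz functions -/

lemma exists_nhds_inv_mul_mem (G : HomogeneousGroup n) (x₀ : Fin n → ℝ) {s : Set (Fin n → ℝ)}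
    (hs : s ∈ 𝓝 0) : ∃ U ∈ 𝓝 x₀, ∀ x ∈ U, ∀ y ∈ U, G.mul (G.inv x) y ∈ s := by
  have hc : Continuous fun q : (Fin n → ℝ) × (Fin n → ℝ) => G.mul (G.inv q.1) q.2 :=
    G.continuous_mul.comp ((G.continuous_inv.comp continuous_fst).prodMk continuous_snd)
  have h := hc.continuousAt (x := (x₀, x₀))
  have hm : (fun q : (Fin n → ℝ) × (Fin n → ℝ) => G.mul (G.inv q.1) q.2) ⁻¹' s ∈ 𝓝 (x₀, x₀) :=
    h (by simpa [G.inv_mul] using hs)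
  rw [nhds_prod_eq, mem_prod_same_iff] at hm
  obtain ⟨U, hU, hUs⟩ := hm
  exact ⟨U, hU, fun x hx y hy => hUs (mk_mem_prod hx hy)⟩

namespace IsLocLip

lemma continuous (hr : G.IsHomogeneousNorm r) {u : (Fin n → ℝ) → ℝ} (hu : G.IsLocLip r u) :
    Continuous u := by
  refine continuous_iff_continuousAt.2 fun x => ?_
  obtain ⟨U, hU, C, hC, h⟩ := hu x
  refine tendsto_iff_dist_tendsto_zero.2 ?_
  have hlim : Tendsto (fun y => C * r (G.mul (G.inv x) y)) (𝓝 x) (𝓝 0) := by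
    have hc : Continuous fun y => C * r (G.mul (G.inv x) y) :=
      continuous_const.mul (hr.continuous.comp (G.contDiff_mul_left _).continuous)
    simpa [G.inv_mul, hr.map_zero] using hc.tendsto x
  refine squeeze_zero' (Eventually.of_forall fun _ => dist_nonneg) ?_ hlim
  filter_upwards [hU] with y hy
  rw [dist_comm, Real.dist_eq]
  exact h x (mem_of_mem_nhds hU) y hy

lemma comp (hr : G.IsHomogeneousNorm r) {u : (Fin n → ℝ) → ℝ} (hu : G.IsLocLip r u)
    {F : ℝ → ℝ} (hF : ContDiff ℝ 1 F) : G.IsLocLip r (fun x => F (u x)) := by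
  intro x₀
  obtain ⟨U, hU, C, hC, h⟩ := hu x₀
  obtain ⟨K, t, ht, hK⟩ := (hF.contDiffAt (x := u x₀)).exists_lipschitzOnWith
  refine ⟨U ∩ u ⁻¹' t, inter_mem hU ((hu.continuous hr).continuousAt ht), (K + 1) * C,
    by positivity, fun x hx y hy => ?_⟩
  have h1 := hK.dist_le_mul _ hx.2 _ hy.2
  rw [Real.dist_eq, Real.dist_eq] at h1
  have h2 := h x hx.1 y hy.1
  have hr0 := hr.nonneg (G.mul (G.inv x) y)
  have hK0 : (0 : ℝ) ≤ K := K.2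
  calc |F (u x) - F (u y)| ≤ K * |u x - u y| := h1
    _ ≤ (K + 1) * (C * r (G.mul (G.inv x) y)) := by gcongr; linarith
    _ = _ := by ring

lemma mul (hr : G.IsHomogeneousNorm r) {u v : (Fin n → ℝ) → ℝ} (hu : G.IsLocLip r u)
    (hv : G.IsLocLip r v) : G.IsLocLip r (fun x => u x * v x) := by
  intro x₀
  obtain ⟨U, hU, C, hC, h⟩ := hu x₀
  obtain ⟨V, hV, D, hD, k⟩ := hv x₀
  have hA : ∀ᶠ x in 𝓝 x₀, |u x| < |u x₀| + 1 :=
    (hu.continuous hr).abs.continuousAt.eventually_lt continuousAt_const (by simp)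
  have hB : ∀ᶠ x in 𝓝 x₀, |v x| < |v x₀| + 1 :=
    (hv.continuous hr).abs.continuousAt.eventually_lt continuousAt_const (by simp)
  refine ⟨_, inter_mem (inter_mem hU hV) (inter_mem hA hB),
    (|u x₀| + 1) * D + (|v x₀| + 1) * C, by positivity, fun x hx y hy => ?_⟩
  have h1 := h x hx.1.1 y hy.1.1
  have h2 := k x hx.1.2 y hy.1.2
  have h3 : |u x| < |u x₀| + 1 := hx.2.1
  have h4 : |v y| < |v x₀| + 1 := hy.2.2
  have e : u x * v x - u y * v y = u x * (v x - v y) + v y * (u x - u y) := by ring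
  rw [e]
  refine (abs_add_le _ _).trans ?_
  rw [abs_mul, abs_mul, add_mul, _root_.mul_assoc, _root_.mul_assoc]
  gcongr

/-- The map (x, z) ↦ ψ(x ∘ z) is Lipschitz in z near (x₀, 0). With z = x⁻¹ ∘ y small, the Euclidean
norm of z is controlled by r z. -/
lemma of_contDiff (hr : G.IsHomogeneousNorm r) {ψ : (Fin n → ℝ) → ℝ} (hψ : ContDiff ℝ 1 ψ) :
    G.IsLocLip r ψ := by
  intro x₀
  obtain ⟨c, hc, hcr⟩ := hr.exists_mul_norm_le
  have hf : ContDiff ℝ 1 fun q : (Fin n → ℝ) × (Fin n → ℝ) => ψ (G.mul q.1 q.2) :=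
    hψ.comp (G.contDiff_mul.of_le (by exact_mod_cast le_top))
  obtain ⟨K, t, ht, hK⟩ := (hf.contDiffAt (x := (x₀, 0))).exists_lipschitzOnWith
  rw [nhds_prod_eq, mem_prod_iff] at ht
  obtain ⟨A, hA, B, hB, hAB⟩ := ht
  obtain ⟨U, hU, h⟩ := G.exists_nhds_inv_mul_mem x₀
    (inter_mem hB (Metric.closedBall_mem_nhds 0 one_pos))
  refine ⟨U ∩ A, inter_mem hU hA, (K + 1) / c, by positivity, fun x hx y hy => ?_⟩
  have hz := h x hx.1 y hy.1
  have h1 := hK.dist_le_mul (x, 0) (hAB (mk_mem_prod hx.2 (mem_of_mem_nhds hB)))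
    (x, G.mul (G.inv x) y) (hAB (mk_mem_prod hx.2 hz.1))
  simp only [G.mul_zero, G.mul_inv_cancel_left, Real.dist_eq, dist_prod_same_left,
    dist_zero_left] at h1
  have h2 := hcr _ (mem_closedBall_zero_iff.1 hz.2)
  have hK0 : (0 : ℝ) ≤ K := K.2
  calc |ψ x - ψ y| ≤ K * ‖G.mul (G.inv x) y‖ := h1
    _ ≤ (K + 1) * (r (G.mul (G.inv x) y) / c) := by
        gcongr
        · linarith
        · rwa [le_div_iff₀' hc]
    _ = _ := by ring

/-- A locally Lipschitz function with compact support is Lipschitz. -/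
lemma isLipOn_univ (hr : G.IsHomogeneousNorm r) {u : (Fin n → ℝ) → ℝ} (hu : G.IsLocLip r u)
    (hc : HasCompactSupport u) : G.IsLipOn r u univ := by
  have hcont := hu.continuous hr
  obtain ⟨M, hM⟩ := hcont.bounded_above_of_compact_support hc
  have hM0 : 0 ≤ M := (norm_nonneg _).trans (hM 0)
  set K := tsupport u with hK
  have hKc : IsCompact K := hc
  -- `K'` contains every point within r-distance 1 of the support. Farther away the bound 2M on the
  -- difference suffices.
  set K' := (fun q : (Fin n → ℝ) × (Fin n → ℝ) => G.mul q.1 q.2) '' (K ×ˢ {z | r z ≤ 1}) with hK'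
  have hK'c : IsCompact K' := (hKc.prod hr.isCompact_le_one).image G.continuous_mul
  have hd : Continuous fun q : (Fin n → ℝ) × (Fin n → ℝ) => r (G.mul (G.inv q.1) q.2) :=
    hr.continuous.comp
      (G.continuous_mul.comp ((G.continuous_inv.comp continuous_fst).prodMk continuous_snd))
  obtain ⟨C, hC, hCK⟩ : ∃ C : ℝ, 0 < C ∧ ∀ q ∈ K ×ˢ K',
      |u q.1 - u q.2| ≤ C * r (G.mul (G.inv q.1) q.2) := by
    refine (hKc.prod hK'c).induction_on
      (p := fun S => ∃ C : ℝ, 0 < C ∧ ∀ q ∈ S, |u q.1 - u q.2| ≤ C * r (G.mul (G.inv q.1) q.2))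
      ⟨1, one_pos, by simp⟩ ?_ ?_ ?_
    · rintro S T hST ⟨C, hC, h⟩
      exact ⟨C, hC, fun q hq => h q (hST hq)⟩
    · rintro S T ⟨C, hC, h⟩ ⟨D, hD, k⟩
      refine ⟨C + D, by positivity, fun q hq => ?_⟩
      have h0 := hr.nonneg (G.mul (G.inv q.1) q.2)
      rcases hq with hq | hq
      · exact (h q hq).trans (by nlinarith)
      · exact (k q hq).trans (by nlinarith)
    · rintro ⟨x₀, y₀⟩ -
      -- On the diagonal the local Lipschitz bound applies; off it, r(x⁻¹ ∘ y) is locally bounded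
      -- below.
      by_cases hxy : G.mul (G.inv x₀) y₀ = 0
      · have : y₀ = x₀ := by
          rw [G.eq_inv_of_mul_eq_zero hxy, G.inv_inv]
        subst this
        obtain ⟨U, hU, C, hC, h⟩ := hu y₀
        exact ⟨U ×ˢ U, mem_nhdsWithin_of_mem_nhds (prod_mem_nhds hU hU), C, hC,
          fun q hq => h _ hq.1 _ hq.2⟩
      · have hpos := (hr.pos_iff _).2 hxy
        have hev : ∀ᶠ q in 𝓝 (x₀, y₀), r (G.mul (G.inv x₀) y₀) / 2 <
            r (G.mul (G.inv q.1) q.2) :=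
          continuousAt_const.eventually_lt hd.continuousAt (by simpa using hpos)
        refine ⟨_, mem_nhdsWithin_of_mem_nhds hev, (2 * M + 1) / (r (G.mul (G.inv x₀) y₀) / 2),
          by positivity, fun q hq => ?_⟩
        have h1 : |u q.1 - u q.2| ≤ 2 * M := by
          have h2 := hM q.1
          have h3 := hM q.2
          rw [Real.norm_eq_abs] at h2 h3
          exact (abs_sub _ _).trans (by linarith)
        have hq' : r (G.mul (G.inv x₀) y₀) / 2 < r (G.mul (G.inv q.1) q.2) := hq
        rw [div_mul_eq_mul_div, le_div_iff₀ (by positivity)]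
        nlinarith
  have key : ∀ x ∈ K, ∀ y, |u x - u y| ≤ (C + 2 * M) * r (G.mul (G.inv x) y) := by
    intro x hx y
    have h0 := hr.nonneg (G.mul (G.inv x) y)
    by_cases h1 : r (G.mul (G.inv x) y) ≤ 1
    · have h2 := hCK (x, y) (mk_mem_prod hx
        ⟨(x, G.mul (G.inv x) y), mk_mem_prod hx h1, G.mul_inv_cancel_left x y⟩)
      exact h2.trans (by nlinarith)
    · have h2 := hM x
      have h3 := hM y
      rw [Real.norm_eq_abs] at h2 h3
      exact ((abs_sub _ _).trans (add_le_add h2 h3)).trans (by nlinarith)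
  refine ⟨C + 2 * M, by positivity, fun x _ y _ => ?_⟩
  by_cases hx : x ∈ K
  · exact key x hx y
  by_cases hy : y ∈ K
  · have h1 := key y hy x
    rwa [abs_sub_comm, ← hr.symm, G.inv_mul_rev, G.inv_inv] at h1
  · rw [image_eq_zero_of_notMem_tsupport hx, image_eq_zero_of_notMem_tsupport hy]
    simpa using mul_nonneg (by positivity) (hr.nonneg _)

end IsLocLip

/-- The increments of a locally Lipschitz function in a direction of the first layer are
locally of first order. -/
lemma IsLocLip.exists_increment_le (hr : G.IsHomogeneousNorm r) {u : (Fin n → ℝ) → ℝ}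
    (hu : G.IsLocLip r u) (j : G.Horizontal) (x₀ : Fin n → ℝ) :
    ∃ C : ℝ, 0 < C ∧ ∃ U ∈ 𝓝 x₀, ∀ᶠ h in 𝓝[>] (0 : ℝ), ∀ x ∈ U,
      |u (G.mul x (Pi.single j.1 h)) - u x| ≤ C * h := by
  obtain ⟨U, hU, C, hC, hL⟩ := hu x₀
  have hc : Continuous fun q : (Fin n → ℝ) × ℝ => G.mul q.1 (Pi.single j.1 q.2) :=
    G.continuous_mul.comp (continuous_fst.prodMk
      ((continuous_single (A := fun _ : Fin n => ℝ) j.1).comp continuous_snd))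
  have hm : (fun q : (Fin n → ℝ) × ℝ => G.mul q.1 (Pi.single j.1 q.2)) ⁻¹' U ∈ 𝓝 (x₀, (0 : ℝ)) :=
    hc.continuousAt (by simpa [G.mul_zero] using hU)
  rw [nhds_prod_eq, mem_prod_iff] at hm
  obtain ⟨A, hA, B, hB, hAB⟩ := hm
  refine ⟨C * (r (Pi.single j.1 1) + 1), mul_pos hC (by have := hr.nonneg (Pi.single j.1 1); linarith),
    A ∩ U, inter_mem hA hU, ?_⟩
  filter_upwards [mem_nhdsWithin_of_mem_nhds hB, self_mem_nhdsWithin] with h hh hpos x hx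
  have hpos' : 0 < h := hpos
  have h1 := hL x hx.2 _ (hAB (mk_mem_prod hx.1 hh))
  -- A coordinate of weight one scales linearly, so the step has r-length exactly h times that of
  -- the unit vector.
  have h2 : (Pi.single j.1 h : Fin n → ℝ) = G.dilation h (Pi.single j.1 1) := by
    rw [G.dilation_single h 1 j.2, _root_.mul_one]
  rw [G.inv_mul_cancel_left, h2, hr.dilation h hpos', abs_sub_comm] at h1
  exact h1.trans (by nlinarith [mul_pos hC hpos'])

/-! ### Left-invariant fields and horizontal gradients of smooth functions -/

lemma contDiff_leftField (G : HomogeneousGroup n) (i : Fin n) :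
    ContDiff ℝ ((⊤ : ℕ∞) : WithTop ℕ∞) (G.leftField i) :=
  ContDiff.fderiv_apply (f := G.mul) (m := ((⊤ : ℕ∞) : WithTop ℕ∞)) G.contDiff_mul
    contDiff_const contDiff_const (by simp)

lemma hasFDerivAt_mul_left_zero (G : HomogeneousGroup n) (x : Fin n → ℝ) :
    HasFDerivAt (G.mul x) (fderiv ℝ (G.mul x) 0) 0 :=
  ((G.contDiff_mul_left x).differentiable (by simp)).differentiableAt.hasFDerivAt

lemma fderiv_leftField (G : HomogeneousGroup n) {ψ : (Fin n → ℝ) → ℝ} {x : Fin n → ℝ}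
    (hψ : DifferentiableAt ℝ ψ x) (i : Fin n) :
    fderiv ℝ ψ x (G.leftField i x) = fderiv ℝ (fun z => ψ (G.mul x z)) 0 (Pi.single i 1) := by
  have h : HasFDerivAt ψ (fderiv ℝ ψ x) (G.mul x 0) := by
    rw [G.mul_zero]
    exact hψ.hasFDerivAt
  have h2 := (h.comp 0 (G.hasFDerivAt_mul_left_zero x)).fderiv
  simp only [Function.comp_def] at h2
  rw [h2]
  rfl

/-- The differential of the product at the origin is (a, b) ↦ a + b; differentiating x⁻¹ ∘ x = 0
gives the claim. -/
lemma hasFDerivAt_inv_zero (G : HomogeneousGroup n) :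
    HasFDerivAt G.inv (-ContinuousLinearMap.id ℝ (Fin n → ℝ)) 0 := by
  set M : (Fin n → ℝ) × (Fin n → ℝ) → (Fin n → ℝ) := fun q => G.mul q.1 q.2 with hM
  have hD : HasFDerivAt M (fderiv ℝ M (0, 0)) (0, 0) :=
    (G.contDiff_mul.differentiable (by simp)).differentiableAt.hasFDerivAt
  have hI : HasFDerivAt G.inv (fderiv ℝ G.inv 0) 0 :=
    (G.contDiff_inv.differentiable (by simp)).differentiableAt.hasFDerivAt
  have h₁ : ∀ a, fderiv ℝ M (0, 0) (a, 0) = a := by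
    intro a
    have h := HasFDerivAt.comp (f := fun x : Fin n → ℝ => (x, (0 : Fin n → ℝ))) (0 : Fin n → ℝ) hD
      ((hasFDerivAt_id (0 : Fin n → ℝ)).prodMk
      (hasFDerivAt_const (0 : Fin n → ℝ) (0 : Fin n → ℝ)))
    have h' : HasFDerivAt (M ∘ fun x => (x, (0 : Fin n → ℝ))) (ContinuousLinearMap.id ℝ _) 0 := by
      have : (M ∘ fun x => (x, (0 : Fin n → ℝ))) = id := funext fun x => G.mul_zero x
      rw [this]
      exact hasFDerivAt_id _
    simpa using congrArg (fun L => L a) (h.unique h')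
  have h₂ : ∀ a, fderiv ℝ M (0, 0) (0, a) = a := by
    intro a
    have h := HasFDerivAt.comp (f := fun x : Fin n → ℝ => ((0 : Fin n → ℝ), x)) (0 : Fin n → ℝ) hD
      ((hasFDerivAt_const (0 : Fin n → ℝ) (0 : Fin n → ℝ)).prodMk
      (hasFDerivAt_id (0 : Fin n → ℝ)))
    have h' : HasFDerivAt (M ∘ fun x => ((0 : Fin n → ℝ), x)) (ContinuousLinearMap.id ℝ _) 0 := by
      have : (M ∘ fun x => ((0 : Fin n → ℝ), x)) = id := funext fun x => G.zero_mul x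
      rw [this]
      exact hasFDerivAt_id _
    simpa using congrArg (fun L => L a) (h.unique h')
  have hD' : HasFDerivAt M (fderiv ℝ M (0, 0)) (G.inv 0, 0) := by rwa [G.inv_zero]
  have h := HasFDerivAt.comp (f := fun x => (G.inv x, id x)) (0 : Fin n → ℝ) hD'
    (hI.prodMk (hasFDerivAt_id (0 : Fin n → ℝ)))
  have h' : HasFDerivAt (M ∘ fun x => (G.inv x, id x))
      (0 : (Fin n → ℝ) →L[ℝ] (Fin n → ℝ)) 0 := by
    have : (M ∘ fun x => (G.inv x, id x)) = fun _ => 0 := funext fun x => G.inv_mul x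
    rw [this]
    exact hasFDerivAt_const _ _
  have hL : fderiv ℝ G.inv 0 = -ContinuousLinearMap.id ℝ (Fin n → ℝ) := by
    ext1 a
    have e := congrArg (fun L => L a) (h.unique h')
    simp only [ContinuousLinearMap.comp_apply, ContinuousLinearMap.prod_apply,
      ContinuousLinearMap.id_apply, _root_.zero_apply] at e
    have e2 : ((fderiv ℝ G.inv 0) a, a) = ((fderiv ℝ G.inv 0) a, 0) + (0, a) := by simp
    rw [e2, map_add, h₁, h₂] at e
    simpa using eq_neg_of_add_eq_zero_left e
  rwa [hL] at hI

lemma hasDerivAt_single (i : Fin n) :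
    HasDerivAt (fun t : ℝ => (Pi.single i t : Fin n → ℝ)) (Pi.single i 1) 0 := by
  have := (ContinuousLinearMap.single ℝ (fun _ : Fin n => ℝ) i).hasDerivAt (x := 0)
  simpa using this

lemma hasDerivAt_mul_inv_single (G : HomogeneousGroup n) {ψ : (Fin n → ℝ) → ℝ} {x : Fin n → ℝ}
    (hψ : DifferentiableAt ℝ ψ x) (i : Fin n) :
    HasDerivAt (fun t : ℝ => ψ (G.mul x (G.inv (Pi.single i t))))
      (-fderiv ℝ ψ x (G.leftField i x)) 0 := by
  have h1 : HasDerivAt (fun t : ℝ => G.inv (Pi.single i t)) (-Pi.single i 1) 0 := by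
    have := (show HasFDerivAt G.inv (-ContinuousLinearMap.id ℝ (Fin n → ℝ))
      (Pi.single i (0 : ℝ)) by simpa using G.hasFDerivAt_inv_zero).comp_hasDerivAt (0 : ℝ)
      (hasDerivAt_single i)
    exact this.congr_deriv (by simp)
  have h2 : HasFDerivAt (G.mul x) (fderiv ℝ (G.mul x) 0) (G.inv (Pi.single i (0 : ℝ))) := by
    simpa [G.inv_zero] using G.hasFDerivAt_mul_left_zero x
  have h3 : HasFDerivAt ψ (fderiv ℝ ψ x) (G.mul x (G.inv (Pi.single i (0 : ℝ)))) := by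
    simpa [G.inv_zero, G.mul_zero] using hψ.hasFDerivAt
  have := h3.comp_hasDerivAt (0 : ℝ) (h2.comp_hasDerivAt (0 : ℝ) h1)
  simpa [leftField, Function.comp_def] using this

/-- The horizontal gradient of a differentiable function. -/
noncomputable def hgrad (G : HomogeneousGroup n) (ψ : (Fin n → ℝ) → ℝ) (x : Fin n → ℝ) :
    EuclideanSpace ℝ G.Horizontal :=
  WithLp.toLp 2 fun j => fderiv ℝ ψ x (G.leftField j.1 x)

lemma hgrad_apply (ψ : (Fin n → ℝ) → ℝ) (x : Fin n → ℝ) (j : G.Horizontal) :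
    G.hgrad ψ x j = fderiv ℝ ψ x (G.leftField j.1 x) := rfl

lemma continuous_hgrad {ψ : (Fin n → ℝ) → ℝ} (hψ : ContDiff ℝ 1 ψ) : Continuous (G.hgrad ψ) := by
  refine (PiLp.continuous_toLp 2 _).comp (continuous_pi fun j => ?_)
  exact (hψ.continuous_fderiv (by simp)).clm_apply (G.contDiff_leftField j.1).continuous

/-- First-layer directions are eigenvectors of δ_R with eigenvalue R. Applied with 1/R, this gives
the gradient decay of the cutoff functions. -/
lemma hgrad_comp_dilation {ψ : (Fin n → ℝ) → ℝ} (hψ : ContDiff ℝ 1 ψ) {R : ℝ} (hR : 0 < R)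
    (x : Fin n → ℝ) :
    G.hgrad (fun x => ψ (G.dilation R x)) x = R • G.hgrad ψ (G.dilation R x) := by
  have hd : Differentiable ℝ ψ := hψ.differentiable (by simp)
  ext j
  rw [PiLp.smul_apply, hgrad_apply, hgrad_apply, fderiv_leftField G hd.differentiableAt,
    fderiv_leftField G (ψ := fun x => ψ (G.dilation R x))
      (hd.comp (G.dilationL R).differentiable).differentiableAt]
  simp_rw [G.dilation_mul' hR]
  have h1 : HasFDerivAt (fun z => ψ (G.mul (G.dilation R x) z))
      (fderiv ℝ (fun z => ψ (G.mul (G.dilation R x) z)) 0) (G.dilation R 0) := by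
    rw [G.dilation_zero]
    exact ((hd.comp ((G.contDiff_mul_left _).differentiable (by simp)))).differentiableAt.hasFDerivAt
  have h2 := h1.comp 0 (G.dilationL R).hasFDerivAt
  have h3 := h2.fderiv
  simp only [Function.comp_def] at h3
  rw [h3, ContinuousLinearMap.comp_apply, dilationL_apply, G.dilation_single _ _ j.2,
    _root_.mul_one]
  have : (Pi.single j.1 R : Fin n → ℝ) = R • Pi.single j.1 1 := by
    rw [← Pi.single_smul, smul_eq_mul, _root_.mul_one]
  rw [this, map_smul]

/-! ### Difference quotients along the first layer -/

lemma isCompact_mul_single (G : HomogeneousGroup n) {K : Set (Fin n → ℝ)} (hK : IsCompact K)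
    (i : Fin n) :
    IsCompact ((fun q : (Fin n → ℝ) × ℝ => G.mul q.1 (Pi.single i q.2)) '' (K ×ˢ Icc 0 1)) :=
  (hK.prod isCompact_Icc).image (G.continuous_mul.comp (continuous_fst.prodMk
      ((continuous_single (A := fun _ : Fin n => ℝ) i).comp continuous_snd)))

/-- Invariance of the measure under right translation moves the shift from u to ψ, where it becomes
a shift by the inverse. -/
lemma integral_differenceQuotient_mul {u ψ : (Fin n → ℝ) → ℝ} (hu : Continuous u)
    (hψ : Continuous ψ) (hc : HasCompactSupport ψ) (i : Fin n) (h : ℝ) :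
    ∫ x, (u (G.mul x (Pi.single i h)) - u x) / h * ψ x =
      ∫ x, u x * ((ψ (G.mul x (G.inv (Pi.single i h))) - ψ x) / h) := by
  set y : Fin n → ℝ := Pi.single i h
  have hcy : HasCompactSupport fun x => ψ (G.mul x (G.inv y)) :=
    hc.comp_homeomorph (G.rightTranslation (G.inv y))
  have hcont : Continuous fun x => ψ (G.mul x (G.inv y)) :=
    hψ.comp (G.contDiff_mul_right _).continuous
  have huy : Continuous fun x => u (G.mul x y) := hu.comp (G.contDiff_mul_right _).continuous
  have e := G.integral_mul_right (fun x => u x * ψ (G.mul x (G.inv y))) y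
  simp only [G.mul_inv_cancel_right] at e
  have i1 : Integrable fun x => u (G.mul x y) * ψ x :=
    (huy.mul hψ).integrable_of_hasCompactSupport hc.mul_left
  have i2 : Integrable fun x => u x * ψ x :=
    (hu.mul hψ).integrable_of_hasCompactSupport hc.mul_left
  have i3 : Integrable fun x => u x * ψ (G.mul x (G.inv y)) :=
    (hu.mul hcont).integrable_of_hasCompactSupport hcy.mul_left
  calc ∫ x, (u (G.mul x y) - u x) / h * ψ x
      = ∫ x, (u (G.mul x y) * ψ x - u x * ψ x) / h := by congr 1; ext x; ring
    _ = ∫ x, (u x * ψ (G.mul x (G.inv y)) - u x * ψ x) / h := by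
        rw [integral_div, integral_div, integral_sub i1 i2, integral_sub i3 i2, e]
    _ = _ := by congr 1; ext x; ring

/-- The difference quotients of a continuous function converge in the sense of distributions. -/
lemma tendsto_integral_differenceQuotient_mul (hr : G.IsHomogeneousNorm r)
    {u ψ : (Fin n → ℝ) → ℝ} (hu : Continuous u) (hψ : ContDiff ℝ 1 ψ) (hc : HasCompactSupport ψ)
    (j : G.Horizontal) :
    Tendsto (fun h : ℝ => ∫ x, (u (G.mul x (Pi.single j.1 h)) - u x) / h * ψ x) (𝓝[>] 0)
      (𝓝 (-∫ x, u x * fderiv ℝ ψ x (G.leftField j.1 x))) := by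
  simp_rw [integral_differenceQuotient_mul (G := G) hu hψ.continuous hc]
  obtain ⟨C, hC, hL⟩ := (IsLocLip.of_contDiff hr hψ).isLipOn_univ hr hc
  -- For 0 < h ≤ 1 the shifted and the unshifted test function both vanish off this compact set.
  set K := (fun q : (Fin n → ℝ) × ℝ => G.mul q.1 (Pi.single j.1 q.2)) '' (tsupport ψ ×ˢ Icc 0 1)
    with hK
  have hKc : IsCompact K := G.isCompact_mul_single hc j.1
  rw [← integral_neg]
  refine tendsto_integral_filter_of_dominated_convergence
    (K.indicator fun x => |u x| * (C * r (Pi.single j.1 1))) ?_ ?_ ?_ ?_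
  · refine Eventually.of_forall fun h => Continuous.aestronglyMeasurable ?_
    exact hu.mul (((hψ.continuous.comp (G.contDiff_mul_right _).continuous).sub
      hψ.continuous).div_const _)
  · filter_upwards [self_mem_nhdsWithin, mem_nhdsWithin_of_mem_nhds (Iic_mem_nhds one_pos)]
      with h hpos h1
    have hpos' : 0 < h := hpos
    refine Eventually.of_forall fun x => ?_
    by_cases hx : x ∈ K
    · rw [indicator_of_mem hx, norm_mul, Real.norm_eq_abs, Real.norm_eq_abs, abs_div,
        abs_of_pos hpos']
      gcongr
      rw [div_le_iff₀ hpos', abs_sub_comm]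
      have h2 := hL x (mem_univ _) (G.mul x (G.inv (Pi.single j.1 h))) (mem_univ _)
      rw [G.inv_mul_cancel_left, hr.symm,
        show (Pi.single j.1 h : Fin n → ℝ) = G.dilation h (Pi.single j.1 1) by
          rw [G.dilation_single h 1 j.2, _root_.mul_one], hr.dilation h hpos'] at h2
      rw [show (Pi.single j.1 h : Fin n → ℝ) = G.dilation h (Pi.single j.1 1) by
          rw [G.dilation_single h 1 j.2, _root_.mul_one]]
      linarith
    · rw [indicator_of_notMem hx]
      have e1 : ψ x = 0 := by
        refine image_eq_zero_of_notMem_tsupport fun hx' => hx ?_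
        exact ⟨(x, 0), mk_mem_prod hx' (by simp), by simp [G.mul_zero]⟩
      have e2 : ψ (G.mul x (G.inv (Pi.single j.1 h))) = 0 := by
        refine image_eq_zero_of_notMem_tsupport fun hx' => hx ?_
        exact ⟨(_, h), mk_mem_prod hx' ⟨hpos'.le, h1⟩, G.inv_mul_cancel_right _ _⟩
      simp [e1, e2]
  · rw [integrable_indicator_iff hKc.measurableSet]
    exact (hu.abs.mul continuous_const).continuousOn.integrableOn_compact hKc
  · refine Eventually.of_forall fun x => ?_
    have hd := G.hasDerivAt_mul_inv_single
      ((hψ.differentiable (by simp)).differentiableAt (x := x)) j.1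
    have hs := hd.tendsto_slope_zero_right
    simp only [Pi.single_zero, G.inv_zero, G.mul_zero, zero_add, smul_eq_mul] at hs
    have := (hs.const_mul (u x))
    rw [mul_neg] at this
    refine this.congr fun h => ?_
    ring

/-! ### Weak horizontal gradients of locally Lipschitz functions -/

lemma IsLocLip.exists_increment_le_of_isCompact (hr : G.IsHomogeneousNorm r)
    {u : (Fin n → ℝ) → ℝ} (hu : G.IsLocLip r u) (j : G.Horizontal) {K : Set (Fin n → ℝ)}
    (hK : IsCompact K) :
    ∃ C : ℝ, 0 < C ∧ ∀ᶠ h in 𝓝[>] (0 : ℝ), ∀ x ∈ K,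
      |u (G.mul x (Pi.single j.1 h)) - u x| ≤ C * h := by
  refine hK.induction_on (p := fun S => ∃ C : ℝ, 0 < C ∧ ∀ᶠ h in 𝓝[>] (0 : ℝ), ∀ x ∈ S,
      |u (G.mul x (Pi.single j.1 h)) - u x| ≤ C * h) ⟨1, one_pos, by simp⟩ ?_ ?_ ?_
  · rintro S T hST ⟨C, hC, h⟩
    exact ⟨C, hC, h.mono fun t ht x hx => ht x (hST hx)⟩
  · rintro S T ⟨C, hC, h⟩ ⟨D, hD, k⟩
    refine ⟨C + D, by positivity, ?_⟩
    filter_upwards [h, k, self_mem_nhdsWithin] with t h1 h2 ht x hx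
    have ht' : 0 < t := ht
    rcases hx with hx | hx
    · exact (h1 x hx).trans (by nlinarith)
    · exact (h2 x hx).trans (by nlinarith)
  · intro x _
    obtain ⟨C, hC, U, hU, h⟩ := hu.exists_increment_le hr j x
    exact ⟨U, mem_nhdsWithin_of_mem_nhds hU, C, hC, h⟩

namespace IsWeakHorizontalGradient

variable {u : (Fin n → ℝ) → ℝ} {g : (Fin n → ℝ) → EuclideanSpace ℝ G.Horizontal}

lemma locallyIntegrable_apply (hg : G.IsWeakHorizontalGradient u g) (j : G.Horizontal) :
    LocallyIntegrable fun x => g x j := fun x => by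
  obtain ⟨s, hs, hi⟩ := hg.1 x
  exact ⟨s, hs, (EuclideanSpace.proj j : EuclideanSpace ℝ G.Horizontal →L[ℝ] ℝ).integrable_comp hi⟩

lemma tendsto_of_contDiff (hr : G.IsHomogeneousNorm r) (hu : Continuous u)
    (hg : G.IsWeakHorizontalGradient u g) (j : G.Horizontal) {ψ : (Fin n → ℝ) → ℝ}
    (hψ : ContDiff ℝ ((⊤ : ℕ∞) : WithTop ℕ∞) ψ) (hc : HasCompactSupport ψ) :
    Tendsto (fun h : ℝ => ∫ x, (u (G.mul x (Pi.single j.1 h)) - u x) / h * ψ x) (𝓝[>] 0)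
      (𝓝 (∫ x, g x j * ψ x)) := by
  have h := tendsto_integral_differenceQuotient_mul hr hu (hψ.of_le (by exact_mod_cast le_top)) hc j
  rwa [hg.2 ψ hψ hc j, neg_neg] at h

/-- The difference quotients are bounded by C, so the pairing of `g` with a nonnegative test
function is at most C times its mass. Testing with shrinking normalized bumps recovers `g` at almost
every point. -/
lemma exists_ae_abs_le (hr : G.IsHomogeneousNorm r) (hu : G.IsLocLip r u)
    (hg : G.IsWeakHorizontalGradient u g) (j : G.Horizontal) (x₀ : Fin n → ℝ) :
    ∃ C : ℝ, ∃ U ∈ 𝓝 x₀, ∀ᵐ x, x ∈ U → |g x j| ≤ C := by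
  obtain ⟨C, hC, U, hU, hinc⟩ := hu.exists_increment_le hr j x₀
  obtain ⟨δ, hδ, hball⟩ := Metric.mem_nhds_iff.1 hU
  have key : ∀ ψ : (Fin n → ℝ) → ℝ, ContDiff ℝ ((⊤ : ℕ∞) : WithTop ℕ∞) ψ → HasCompactSupport ψ →
      (∀ x, 0 ≤ ψ x) → (∀ x, x ∉ U → ψ x = 0) → |∫ x, g x j * ψ x| ≤ C * ∫ x, ψ x := by
    intro ψ hψ hc h0 hs
    refine le_of_tendsto (hg.tendsto_of_contDiff hr (hu.continuous hr) j hψ hc).abs ?_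
    filter_upwards [hinc, self_mem_nhdsWithin] with h hh hpos
    have hpos' : 0 < h := hpos
    have hi : Integrable ψ := hψ.continuous.integrable_of_hasCompactSupport hc
    rw [← integral_const_mul, ← Real.norm_eq_abs]
    refine norm_integral_le_of_norm_le (hi.const_mul C)
      (Eventually.of_forall fun x => ?_)
    by_cases hx : x ∈ U
    · rw [norm_mul, Real.norm_eq_abs, Real.norm_eq_abs, abs_div, abs_of_pos hpos',
        abs_of_nonneg (h0 x)]
      have h00 := h0 x
      gcongr
      rw [div_le_iff₀ hpos']
      exact hh x hx
    · simp [hs x hx]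
  -- The ratio of the radii is fixed at 2, as almost-everywhere convergence of these convolutions
  -- requires.
  let φ : ℕ → ContDiffBump (0 : Fin n → ℝ) := fun k =>
    { rIn := 1 / ((k : ℝ) + 1), rOut := 2 * (1 / ((k : ℝ) + 1)), rIn_pos := by positivity,
      rIn_lt_rOut := by
        have : 0 < 1 / ((k : ℝ) + 1) := by positivity
        linarith }
  have hφ : Tendsto (fun k => (φ k).rOut) atTop (𝓝 0) := by
    have h := (tendsto_one_div_add_atTop_nhds_zero_nat (𝕜 := ℝ)).const_mul 2
    rw [MulZeroClass.mul_zero] at h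
    exact h
  refine ⟨C, Metric.ball x₀ (δ / 2), Metric.ball_mem_nhds _ (by positivity), ?_⟩
  filter_upwards [ContDiffBump.ae_convolution_tendsto_right_of_locallyIntegrable (μ := volume)
    (K := 2) hφ (Eventually.of_forall fun k => le_rfl) (hg.locallyIntegrable_apply j)] with x hx hxU
  refine le_of_tendsto hx.abs ?_
  filter_upwards [hφ.eventually_lt_const (show 0 < δ / 2 by positivity)] with k hk
  have hcd : ContDiff ℝ ((⊤ : ℕ∞) : WithTop ℕ∞) fun t => (φ k).normed volume (x - t) :=
    (φ k).contDiff_normed.comp (contDiff_const.sub contDiff_id)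
  have hcs : HasCompactSupport fun t => (φ k).normed volume (x - t) :=
    (φ k).hasCompactSupport_normed.comp_homeomorph (Homeomorph.subLeft x)
  have h := key _ hcd hcs (fun t => (φ k).nonneg_normed _) fun t ht => by
    by_contra hne
    have : x - t ∈ Function.support ((φ k).normed volume) := hne
    rw [(φ k).support_normed_eq, mem_ball_zero_iff] at this
    refine ht (hball ?_)
    have h1 : dist t x < δ / 2 := by rw [dist_comm, dist_eq_norm]; linarith
    have h2 : dist x x₀ < δ / 2 := hxU
    exact Metric.mem_ball.2 ((dist_triangle _ _ _).trans_lt (by linarith))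
  rw [integral_sub_left_eq_self (fun t => (φ k).normed volume t), (φ k).integral_normed,
    mul_one] at h
  rw [convolution_eq_swap]
  simpa [_root_.mul_comm] using h

/-- The weak gradient of a locally Lipschitz function is locally bounded. -/
lemma exists_ae_norm_le (hr : G.IsHomogeneousNorm r) (hu : G.IsLocLip r u)
    (hg : G.IsWeakHorizontalGradient u g) {K : Set (Fin n → ℝ)} (hK : IsCompact K) :
    ∃ M : ℝ, 0 ≤ M ∧ ∀ᵐ x, x ∈ K → ‖g x‖ ≤ M := by
  refine hK.induction_on (p := fun S => ∃ M : ℝ, 0 ≤ M ∧ ∀ᵐ x, x ∈ S → ‖g x‖ ≤ M)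
    ⟨0, le_rfl, by simp⟩ ?_ ?_ ?_
  · rintro S T hST ⟨M, hM, h⟩
    exact ⟨M, hM, h.mono fun x hx hxS => hx (hST hxS)⟩
  · rintro S T ⟨M, hM, h⟩ ⟨N, hN, k⟩
    refine ⟨M + N, by positivity, ?_⟩
    filter_upwards [h, k] with x h1 h2 hx
    rcases hx with hx | hx
    · exact (h1 hx).trans (by linarith)
    · exact (h2 hx).trans (by linarith)
  · intro x₀ _
    choose C U hU h using fun j => hg.exists_ae_abs_le hr hu j x₀
    refine ⟨⋂ j, U j, mem_nhdsWithin_of_mem_nhds (iInter_mem.2 hU), √(∑ j, C j ^ 2),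
      Real.sqrt_nonneg _, ?_⟩
    filter_upwards [ae_all_iff.2 h] with x hx hxU
    rw [EuclideanSpace.norm_eq]
    refine Real.sqrt_le_sqrt (Finset.sum_le_sum fun j _ => ?_)
    have := hx j (mem_iInter.1 hxU j)
    rw [Real.norm_eq_abs]
    gcongr

/-- The difference quotients of a locally Lipschitz function converge weakly to the weak gradient,
tested against continuous functions with compact support. -/
lemma tendsto_of_continuous (hr : G.IsHomogeneousNorm r) (hu : G.IsLocLip r u)
    (hg : G.IsWeakHorizontalGradient u g) (j : G.Horizontal) {f : (Fin n → ℝ) → ℝ}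
    (hf : Continuous f) (hc : HasCompactSupport f) :
    Tendsto (fun h : ℝ => ∫ x, (u (G.mul x (Pi.single j.1 h)) - u x) / h * f x) (𝓝[>] 0)
      (𝓝 (∫ x, g x j * f x)) := by
  have hcu := hu.continuous hr
  set K := tsupport f with hK
  have hKc : IsCompact K := hc
  obtain ⟨C, hC, hinc⟩ := hu.exists_increment_le_of_isCompact hr j hKc
  have hgK : IntegrableOn (fun x => |g x j|) K :=
    ((hg.locallyIntegrable_apply j).integrableOn_isCompact hKc).abs
  set A := ∫ x in K, |g x j| with hA
  have hA0 : 0 ≤ A := integral_nonneg fun x => abs_nonneg _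
  set B := C * volume.real K with hB
  have hB0 : 0 ≤ B := by positivity
  rw [Metric.tendsto_nhds]
  intro ε hε
  set η := ε / (2 * (A + B + 1)) with hη
  have hη0 : 0 < η := by positivity
  obtain ⟨ψ, hψ, hψf, hsupp⟩ := hf.exists_contDiff_approx (ε := fun _ => η) ⊤ continuous_const
    (fun _ => hη0)
  have hψc : HasCompactSupport ψ := hc.mono hsupp
  have hzero : ∀ x, x ∉ K → f x = 0 ∧ ψ x = 0 := fun x hx => by
    have h1 : f x = 0 := image_eq_zero_of_notMem_tsupport hx
    refine ⟨h1, ?_⟩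
    by_contra h2
    exact hsupp h2 h1
  -- The smooth ψ is uniformly within η of f. Replacing f by ψ costs ηA in the limit and ηB in the
  -- quotients, uniformly in h, together less than ε / 2.
  have hlim := Metric.tendsto_nhds.1 (hg.tendsto_of_contDiff hr hcu j hψ hψc) (ε / 2)
    (by positivity)
  have e1 : |∫ x, g x j * f x - g x j * ψ x| ≤ η * A := by
    rw [hA, ← integral_const_mul, ← integral_indicator hKc.measurableSet, ← Real.norm_eq_abs]
    refine norm_integral_le_of_norm_le
      ((integrable_indicator_iff hKc.measurableSet).2 (hgK.const_mul η))
      (Eventually.of_forall fun x => ?_)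
    by_cases hx : x ∈ K
    · rw [indicator_of_mem hx, ← mul_sub, norm_mul, Real.norm_eq_abs, _root_.mul_comm]
      gcongr
      rw [← dist_eq_norm, dist_comm]
      exact (hψf x).le
    · simp [hzero x hx, hx]
  have i1 : Integrable fun x => g x j * f x := by
    simpa [_root_.mul_comm] using
      (hg.locallyIntegrable_apply j).integrable_smul_left_of_hasCompactSupport hf hc
  have i2 : Integrable fun x => g x j * ψ x := by
    simpa [_root_.mul_comm] using
      (hg.locallyIntegrable_apply j).integrable_smul_left_of_hasCompactSupport hψ.continuous hψc
  filter_upwards [hlim, hinc, self_mem_nhdsWithin] with h hh hh' hpos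
  have hpos' : 0 < h := hpos
  have hq : Continuous fun x => (u (G.mul x (Pi.single j.1 h)) - u x) / h :=
    ((hcu.comp (G.contDiff_mul_right _).continuous).sub hcu).div_const _
  have e2 : |∫ x, (u (G.mul x (Pi.single j.1 h)) - u x) / h * f x -
      (u (G.mul x (Pi.single j.1 h)) - u x) / h * ψ x| ≤ η * B := by
    have hBi : η * B = ∫ x, K.indicator (fun _ => η * C) x := by
      rw [integral_indicator hKc.measurableSet, setIntegral_const, hB, smul_eq_mul]
      ring
    have hi : Integrable (K.indicator fun _ => η * C) :=
      (integrable_indicator_iff hKc.measurableSet).2 (integrableOn_const hKc.measure_lt_top.ne)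
    rw [hBi, ← Real.norm_eq_abs]
    refine norm_integral_le_of_norm_le hi
      (Eventually.of_forall fun x => ?_)
    by_cases hx : x ∈ K
    · rw [indicator_of_mem hx, ← mul_sub, norm_mul, _root_.mul_comm]
      gcongr
      · rw [← dist_eq_norm, dist_comm]
        exact (hψf x).le
      · rw [Real.norm_eq_abs, abs_div, abs_of_pos hpos', div_le_iff₀ hpos']
        exact hh' x hx
    · simp [hzero x hx, hx]
  rw [integral_sub i1 i2] at e1
  have i3 : Integrable fun x => (u (G.mul x (Pi.single j.1 h)) - u x) / h * f x :=
    (hq.mul hf).integrable_of_hasCompactSupport hc.mul_left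
  have i4 : Integrable fun x => (u (G.mul x (Pi.single j.1 h)) - u x) / h * ψ x :=
    (hq.mul hψ.continuous).integrable_of_hasCompactSupport hψc.mul_left
  rw [integral_sub i3 i4] at e2
  rw [Real.dist_eq] at hh ⊢
  have e3 : η * (A + B) < ε / 2 := by
    rw [hη, div_mul_eq_mul_div, div_lt_div_iff₀ (by positivity) two_pos]
    nlinarith
  rw [abs_lt] at hh ⊢
  rw [abs_le] at e1 e2
  constructor <;> linarith [e1.1, e1.2, e2.1, e2.2, hh.1, hh.2]

/-- The chain rule. -/
lemma comp (hr : G.IsHomogeneousNorm r) (hu : G.IsLocLip r u)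
    (hg : G.IsWeakHorizontalGradient u g) {F : ℝ → ℝ} (hF : ContDiff ℝ 1 F) :
    G.IsWeakHorizontalGradient (fun x => F (u x)) (fun x => deriv F (u x) • g x) := by
  have hcu := hu.continuous hr
  have hF' : Continuous fun x => deriv F (u x) := (hF.continuous_deriv le_rfl).comp hcu
  have hFu := hu.comp hr hF
  have hcFu := hFu.continuous hr
  refine ⟨LocallyIntegrable.continuous_smul hF' hg.1, fun ψ hψ hc j => ?_⟩
  have h1 := tendsto_integral_differenceQuotient_mul hr (hFu.continuous hr)
    (hψ.of_le (by exact_mod_cast le_top)) hc j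
  -- The weight F'(u) is merely continuous, so weak convergence against continuous test functions is
  -- needed here.
  have h2 := hg.tendsto_of_continuous hr hu j (f := fun x => deriv F (u x) * ψ x)
    (hF'.mul hψ.continuous) hc.mul_left
  obtain ⟨C, hC, hinc⟩ := hu.exists_increment_le_of_isCompact hr j (K := tsupport ψ) hc
  obtain ⟨D, hD, hincF⟩ := hFu.exists_increment_le_of_isCompact hr j (K := tsupport ψ) hc
  have hq : ∀ h, Continuous fun x => (u (G.mul x (Pi.single j.1 h)) - u x) / h := fun h =>
    ((hcu.comp (G.contDiff_mul_right _).continuous).sub hcu).div_const _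
  have hqF : ∀ h, Continuous fun x => (F (u (G.mul x (Pi.single j.1 h))) - F (u x)) / h := fun h =>
    ((hcFu.comp (G.contDiff_mul_right _).continuous).sub hcFu).div_const _
  -- The quotients of u need not converge pointwise, but the first-order Taylor error of F does: it
  -- is o(1) since the increments of u are O(h).
  have h3 : Tendsto (fun h : ℝ => ∫ x, ((F (u (G.mul x (Pi.single j.1 h))) - F (u x)) / h * ψ x -
      (u (G.mul x (Pi.single j.1 h)) - u x) / h * (deriv F (u x) * ψ x))) (𝓝[>] 0)
      (𝓝 (∫ _ : Fin n → ℝ, (0 : ℝ))) := by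
    refine tendsto_integral_filter_of_dominated_convergence
      (fun x => D * |ψ x| + C * |deriv F (u x) * ψ x|) ?_ ?_ ?_ ?_
    · exact Eventually.of_forall fun h => (((hqF h).mul hψ.continuous).sub
        ((hq h).mul (hF'.mul hψ.continuous))).aestronglyMeasurable
    · filter_upwards [hinc, hincF, self_mem_nhdsWithin] with h k1 k2 hpos
      have hpos' : 0 < h := hpos
      refine Eventually.of_forall fun x => ?_
      by_cases hx : x ∈ tsupport ψ
      · refine (norm_sub_le _ _).trans ?_
        rw [norm_mul, norm_mul _ (deriv F (u x) * ψ x)]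
        simp only [Real.norm_eq_abs, abs_div, abs_of_pos hpos']
        gcongr
        · rw [div_le_iff₀ hpos']
          exact k2 x hx
        · rw [div_le_iff₀ hpos']
          exact k1 x hx
      · simp [image_eq_zero_of_notMem_tsupport hx]
    · have hc' : HasCompactSupport fun x => D * |ψ x| + C * |deriv F (u x) * ψ x| :=
        hc.mono' fun x hx => by
          by_contra h0
          simp [image_eq_zero_of_notMem_tsupport h0] at hx
      exact ((continuous_const.mul hψ.continuous.abs).add (continuous_const.mul
        (hF'.mul hψ.continuous).abs)).integrable_of_hasCompactSupport hc'
    · refine Eventually.of_forall fun x => ?_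
      have hd := ((hF.differentiable (by simp)).differentiableAt (x := u x)).hasDerivAt
      have ht : Tendsto (fun h : ℝ => u (G.mul x (Pi.single j.1 h)) - u x) (𝓝[>] 0) (𝓝 0) := by
        have hcont : Continuous fun h : ℝ => u (G.mul x (Pi.single j.1 h)) - u x :=
          (hcu.comp ((G.contDiff_mul_left x).continuous.comp
            (continuous_single (A := fun _ : Fin n => ℝ) j.1))).sub continuous_const
        have := hcont.tendsto 0
        simp only [Pi.single_zero, G.mul_zero, sub_self] at this
        exact this.mono_left nhdsWithin_le_nhds
      have hO : (fun h : ℝ => u (G.mul x (Pi.single j.1 h)) - u x) =O[𝓝[>] 0] fun h => h := by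
        obtain ⟨C', hC', U, hU, hi⟩ := hu.exists_increment_le hr j x
        refine Asymptotics.IsBigO.of_bound C' ?_
        filter_upwards [hi, self_mem_nhdsWithin] with h hh hpos
        rw [Real.norm_eq_abs, Real.norm_eq_abs, abs_of_pos (show 0 < h from hpos)]
        exact hh x (mem_of_mem_nhds hU)
      have ho := ((hasDerivAt_iff_isLittleO_nhds_zero.1 hd).comp_tendsto ht).trans_isBigO hO
      have hlim := (ho.tendsto_div_nhds_zero).mul_const (ψ x)
      rw [MulZeroClass.zero_mul] at hlim
      refine hlim.congr fun h => ?_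
      simp only [Function.comp_apply, smul_eq_mul, add_sub_cancel]
      ring
  rw [integral_zero] at h3
  have h4 := h3.add h2
  rw [zero_add] at h4
  have h5 := tendsto_nhds_unique h1 (h4.congr fun h => by
    rw [← integral_add]
    · congr 1
      ext x
      ring
    · exact (((hqF h).mul hψ.continuous).sub ((hq h).mul
        (hF'.mul hψ.continuous))).integrable_of_hasCompactSupport
          (hc.mono' fun x hx => by
            by_contra h0
            simp [image_eq_zero_of_notMem_tsupport h0] at hx)
    · exact ((hq h).mul (hF'.mul hψ.continuous)).integrable_of_hasCompactSupport
        hc.mul_left.mul_left)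
  rw [← neg_eq_iff_eq_neg, h5]
  congr 1
  ext x
  simp only [PiLp.smul_apply, smul_eq_mul]
  ring

/-- The product rule with a smooth factor. -/
lemma mul_contDiff (hu : Continuous u) (hg : G.IsWeakHorizontalGradient u g)
    {ζ : (Fin n → ℝ) → ℝ} (hζ : ContDiff ℝ ((⊤ : ℕ∞) : WithTop ℕ∞) ζ) :
    G.IsWeakHorizontalGradient (fun x => u x * ζ x)
      (fun x => ζ x • g x + u x • G.hgrad ζ x) := by
  have hζ1 : ContDiff ℝ 1 ζ := hζ.of_le (by exact_mod_cast le_top)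
  refine ⟨(LocallyIntegrable.continuous_smul hζ.continuous hg.1).add
    (hu.smul (continuous_hgrad hζ1)).locallyIntegrable, fun ψ hψ hc j => ?_⟩
  have hψ1 : ContDiff ℝ 1 ψ := hψ.of_le (by exact_mod_cast le_top)
  -- Testing `g` against ζψ and expanding X_j(ζψ) gives the product rule.
  have e := hg.2 (fun x => ζ x * ψ x) (hζ.mul hψ) hc.mul_left j
  have hX : ∀ f : (Fin n → ℝ) → ℝ, ContDiff ℝ 1 f →
      Continuous fun x => fderiv ℝ f x (G.leftField j.1 x) := fun f hf =>
    (hf.continuous_fderiv (by simp)).clm_apply (G.contDiff_leftField j.1).continuous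
  have hd : ∀ x, fderiv ℝ (fun x => ζ x * ψ x) x (G.leftField j.1 x) =
      ζ x * fderiv ℝ ψ x (G.leftField j.1 x) + ψ x * fderiv ℝ ζ x (G.leftField j.1 x) := fun x => by
    have := fderiv_fun_mul ((hζ1.differentiable (by simp)).differentiableAt (x := x))
      ((hψ1.differentiable (by simp)).differentiableAt (x := x))
    rw [this]
    simp
  have hcX : HasCompactSupport fun x => fderiv ℝ ψ x (G.leftField j.1 x) :=
    (hc.fderiv (𝕜 := ℝ)).mono fun x hx h0 => by simp [h0] at hx
  have i1 : Integrable fun x => u x * ζ x * fderiv ℝ ψ x (G.leftField j.1 x) :=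
    ((hu.mul hζ.continuous).mul (hX ψ hψ1)).integrable_of_hasCompactSupport hcX.mul_left
  have i2 : Integrable fun x => u x * fderiv ℝ ζ x (G.leftField j.1 x) * ψ x :=
    ((hu.mul (hX ζ hζ1)).mul hψ.continuous).integrable_of_hasCompactSupport hc.mul_left
  have i3 : Integrable fun x => g x j * (ζ x * ψ x) := by
    simpa [_root_.mul_comm] using
      (hg.locallyIntegrable_apply j).integrable_smul_left_of_hasCompactSupport
        (hζ.continuous.mul hψ.continuous) hc.mul_left
  have e1 : ∫ x, u x * fderiv ℝ (fun x => ζ x * ψ x) x (G.leftField j.1 x) =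
      (∫ x, u x * ζ x * fderiv ℝ ψ x (G.leftField j.1 x)) +
        ∫ x, u x * fderiv ℝ ζ x (G.leftField j.1 x) * ψ x := by
    rw [← integral_add i1 i2]
    congr 1
    ext x
    rw [hd]
    ring
  have e2 : ∫ x, (ζ x • g x + u x • G.hgrad ζ x) j * ψ x =
      (∫ x, g x j * (ζ x * ψ x)) + ∫ x, u x * fderiv ℝ ζ x (G.leftField j.1 x) * ψ x := by
    rw [← integral_add i3 i2]
    congr 1
    ext x
    simp only [PiLp.add_apply, PiLp.smul_apply, smul_eq_mul, hgrad_apply]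
    ring
  rw [e2]
  linarith

end IsWeakHorizontalGradient

end HomogeneousGroup

/-! ### Parametric integrals with compactly supported smooth kernels -/

section ParametricIntegral

variable {E : Type*} [NormedAddCommGroup E] [NormedSpace ℝ E] [FiniteDimensional ℝ E]
  [MeasurableSpace E] [BorelSpace E] {ν : Measure E} [IsFiniteMeasureOnCompacts ν]
  {F : Type*} [NormedAddCommGroup F] [NormedSpace ℝ F]

/-- The locally uniform compact support of the kernel supplies the dominating function. -/
lemma hasFDerivAt_integral_smul_kernel {v : E → ℝ} (hv : Continuous v) {K : E → E → F}
    (hK : ContDiff ℝ ((⊤ : ℕ∞) : WithTop ℕ∞) (Function.uncurry K))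
    (hs : ∀ x₀, ∃ U ∈ 𝓝 x₀, ∃ S, IsCompact S ∧ ∀ x ∈ U, ∀ z, z ∉ S → K x z = 0) (x₀ : E) :
    Integrable (fun z => v z • fderiv ℝ (fun x => K x z) x₀) ν ∧
    HasFDerivAt (fun x => ∫ z, v z • K x z ∂ν)
      (∫ z, v z • fderiv ℝ (fun x => K x z) x₀ ∂ν) x₀ := by
  obtain ⟨U, hU, S, hS, hUS⟩ := hs x₀
  obtain ⟨δ, hδ, hball⟩ := Metric.nhds_basis_closedBall.mem_iff.1 hU
  have hD : Continuous fun q : E × E => fderiv ℝ (fun x => K x q.2) q.1 := by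
    have h : ContDiff ℝ 1 (Function.uncurry fun (q : E × E) (x : E) => K x q.2) :=
      (hK.of_le (by exact_mod_cast le_top)).comp
        (contDiff_snd.prodMk (contDiff_snd.comp contDiff_fst))
    exact (ContDiff.fderiv (n := 0) (m := 1) h contDiff_fst (by norm_num)).continuous
  obtain ⟨B, hB⟩ := ((isCompact_closedBall x₀ δ).prod hS).exists_bound_of_continuousOn
    hD.continuousOn
  have hKc : ∀ x, Continuous fun z => K x z := fun x =>
    hK.continuous.comp (continuous_const.prodMk continuous_id)
  have hcomp : ∀ {F' : Type _} [NormedAddCommGroup F'] (f : E → F'), Continuous f →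
      (∀ z, z ∉ S → f z = 0) → Integrable f ν := fun f hf h0 =>
    hf.integrable_of_hasCompactSupport (HasCompactSupport.intro hS fun z hz => h0 z hz)
  have hbd : ∀ z, ∀ x ∈ Metric.ball x₀ δ, ‖v z • fderiv ℝ (fun x => K x z) x‖ ≤
      S.indicator (fun z => |v z| * B) z := by
    intro z x hx
    by_cases hz : z ∈ S
    · rw [indicator_of_mem hz, norm_smul, Real.norm_eq_abs]
      gcongr
      exact hB (x, z) (mk_mem_prod (Metric.ball_subset_closedBall hx) hz)
    · rw [indicator_of_notMem hz]
      have : (fun x => K x z) =ᶠ[𝓝 x] fun _ => 0 := by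
        filter_upwards [Metric.isOpen_ball.mem_nhds hx] with y hy
        exact hUS y (hball (Metric.ball_subset_closedBall hy)) z hz
      rw [this.fderiv_eq]
      simp
  have hbi : Integrable (S.indicator fun z => |v z| * B) ν :=
    (integrable_indicator_iff hS.measurableSet).2
      ((hv.abs.mul continuous_const).continuousOn.integrableOn_compact hS)
  have hm : AEStronglyMeasurable (fun z => v z • fderiv ℝ (fun x => K x z) x₀) ν :=
    (hv.smul (hD.comp (continuous_const.prodMk continuous_id))).aestronglyMeasurable
  refine ⟨hbi.mono' hm (Eventually.of_forall fun z => hbd z x₀ (Metric.mem_ball_self hδ)), ?_⟩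
  refine hasFDerivAt_integral_of_dominated_of_fderiv_le (Metric.ball_mem_nhds x₀ hδ)
    (Eventually.of_forall fun x => (hv.smul (hKc x)).aestronglyMeasurable)
    (hcomp _ (hv.smul (hKc x₀)) fun z hz => by
      simp [hUS x₀ (mem_of_mem_nhds hU) z hz]) hm
    (Eventually.of_forall hbd) hbi (Eventually.of_forall fun z x _ => ?_)
  have hd : DifferentiableAt ℝ (fun x => K x z) x :=
    ((hK.comp (contDiff_id.prodMk contDiff_const)).differentiable (by simp)).differentiableAt
  exact hd.hasFDerivAt.const_smul (v z)

end ParametricIntegral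

/-- The derivative is an integral of the same type, with an operator-valued kernel; hence the
induction on k ranges over all target spaces F. -/
lemma contDiff_integral_smul_kernel {E : Type} [NormedAddCommGroup E] [NormedSpace ℝ E]
    [FiniteDimensional ℝ E] [MeasurableSpace E] [BorelSpace E] {ν : Measure E}
    [IsFiniteMeasureOnCompacts ν] (k : ℕ) {v : E → ℝ} (hv : Continuous v) :
    ∀ {F : Type} [NormedAddCommGroup F] [NormedSpace ℝ F] {K : E → E → F},
    ContDiff ℝ ((⊤ : ℕ∞) : WithTop ℕ∞) (Function.uncurry K) →
    (∀ x₀, ∃ U ∈ 𝓝 x₀, ∃ S, IsCompact S ∧ ∀ x ∈ U, ∀ z, z ∉ S → K x z = 0) →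
    ContDiff ℝ k (fun x => ∫ z, v z • K x z ∂ν) := by
  induction k with
  | zero =>
    intro F _ _ K hK hs
    exact contDiff_zero.2 (continuous_iff_continuousAt.2 fun x =>
      (hasFDerivAt_integral_smul_kernel hv hK hs x).2.continuousAt)
  | succ k ih =>
    intro F _ _ K hK hs
    push_cast
    refine contDiff_succ_iff_hasFDerivAt.2 ⟨fun x => ∫ z, v z • fderiv ℝ (fun x => K x z) x ∂ν,
      ih (K := fun x z => fderiv ℝ (fun x => K x z) x) ?_ fun x₀ => ?_,
      fun x => (hasFDerivAt_integral_smul_kernel hv hK hs x).2⟩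
    · have h : ContDiff ℝ ((⊤ : ℕ∞) : WithTop ℕ∞)
          (Function.uncurry fun (q : E × E) (x : E) => K x q.2) :=
        hK.comp (contDiff_snd.prodMk (contDiff_snd.comp contDiff_fst))
      exact ContDiff.fderiv (m := ((⊤ : ℕ∞) : WithTop ℕ∞)) h contDiff_fst (by simp)
    · obtain ⟨U, hU, S, hS, hUS⟩ := hs x₀
      refine ⟨interior U, interior_mem_nhds.2 hU, S, hS, fun x hx z hz => ?_⟩
      have : (fun x => K x z) =ᶠ[𝓝 x] fun _ => 0 := by
        filter_upwards [mem_interior_iff_mem_nhds.1 hx] with y hy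
        exact hUS y hy z hz
      rw [this.fderiv_eq]
      simp

/-! ### Functions with vanishing horizontal gradient -/

namespace HomogeneousGroup

variable {n : ℕ} {G : HomogeneousGroup n}

lemma IsIteratedBracket.contDiff {V : (Fin n → ℝ) → (Fin n → ℝ)} (hV : G.IsIteratedBracket V) :
    ContDiff ℝ ((⊤ : ℕ∞) : WithTop ℕ∞) V := by
  induction hV with
  | field i hi => exact G.contDiff_leftField i
  | bracket V W _ _ ihV ihW =>
    exact ((ihW.fderiv_right (m := ((⊤ : ℕ∞) : WithTop ℕ∞)) (by simp)).clm_apply ihV).sub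
      ((ihV.fderiv_right (m := ((⊤ : ℕ∞) : WithTop ℕ∞)) (by simp)).clm_apply ihW)

/-- If a `C²` function is annihilated by the first layer, then it is annihilated by all
iterated brackets. -/
lemma IsIteratedBracket.fderiv_apply_eq_zero {Φ : (Fin n → ℝ) → ℝ} (hΦ : ContDiff ℝ 2 Φ)
    (h0 : ∀ i, G.weight i = 1 → ∀ y, fderiv ℝ Φ y (G.leftField i y) = 0)
    {V : (Fin n → ℝ) → (Fin n → ℝ)} (hV : G.IsIteratedBracket V) (y : Fin n → ℝ) :
    fderiv ℝ Φ y (V y) = 0 := by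
  induction hV generalizing y with
  | field i hi => exact h0 i hi y
  | bracket V W hV hW ihV ihW =>
    have hD : DifferentiableAt ℝ (fderiv ℝ Φ) y :=
      ((hΦ.fderiv_right (m := 1) (by norm_num)).differentiable (by simp)).differentiableAt
    -- Differentiate Φ'(Z) = 0 in the direction a. Applied to both fields, the second-order terms
    -- cancel by symmetry and leave Φ' on the bracket.
    have key : ∀ Z : (Fin n → ℝ) → (Fin n → ℝ), G.IsIteratedBracket Z →
        (∀ y, fderiv ℝ Φ y (Z y) = 0) → ∀ a,
        fderiv ℝ (fderiv ℝ Φ) y a (Z y) + fderiv ℝ Φ y (fderiv ℝ Z y a) = 0 := by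
      intro Z hZ hZ0 a
      have hZd : DifferentiableAt ℝ Z y := (hZ.contDiff.differentiable (by simp)).differentiableAt
      have h1 := hD.hasFDerivAt.clm_apply hZd.hasFDerivAt
      have h2 : HasFDerivAt (fun y => fderiv ℝ Φ y (Z y))
          (0 : (Fin n → ℝ) →L[ℝ] ℝ) y := by
        simp_rw [hZ0]
        exact hasFDerivAt_const _ _
      have := congrArg (fun L => L a) (h1.unique h2)
      simpa [_root_.add_comm] using this
    have hsymm := (hΦ.contDiffAt (x := y)).isSymmSndFDerivAt (by simp) (V y) (W y)
    have e1 := key W hW ihW (V y)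
    have e2 := key V hV ihV (W y)
    rw [VectorField.lieBracket, map_sub]
    linarith

end HomogeneousGroup

namespace HomogeneousCarnotGroup

variable {n : ℕ} {G : HomogeneousCarnotGroup n}

/-- A continuous function whose weak horizontal gradient vanishes is constant. -/
lemma eq_of_isWeakHorizontalGradient_zero {v : (Fin n → ℝ) → ℝ} (hv : Continuous v)
    (hg : G.IsWeakHorizontalGradient v 0) (y : Fin n → ℝ) : v y = v 0 := by
  have hkey : ∀ ψ : (Fin n → ℝ) → ℝ, ContDiff ℝ ((⊤ : ℕ∞) : WithTop ℕ∞) ψ →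
      HasCompactSupport ψ → ∫ z, v (G.mul z y) * ψ z = ∫ z, v z * ψ z := by
    intro ψ hψ hc
    -- Translation is moved onto the test function, so that the integral is smooth in y although v
    -- is only continuous.
    set K : (Fin n → ℝ) → (Fin n → ℝ) → ℝ := fun y z => ψ (G.mul z (G.inv y)) with hKdef
    have hK : ContDiff ℝ ((⊤ : ℕ∞) : WithTop ℕ∞) (Function.uncurry K) :=
      hψ.comp (G.contDiff_mul.comp (contDiff_snd.prodMk (G.contDiff_inv.comp contDiff_fst)))
    have hs : ∀ x₀, ∃ U ∈ 𝓝 x₀, ∃ S, IsCompact S ∧ ∀ x ∈ U, ∀ z, z ∉ S → K x z = 0 := by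
      intro x₀
      refine ⟨_, Metric.closedBall_mem_nhds x₀ one_pos, _,
        (IsCompact.prod hc (isCompact_closedBall x₀ 1)).image G.continuous_mul,
        fun x hx z hz => image_eq_zero_of_notMem_tsupport (f := ψ) fun h => hz ?_⟩
      exact ⟨(_, x), mk_mem_prod h hx, G.inv_mul_cancel_right z x⟩
    set Φ : (Fin n → ℝ) → ℝ := fun y => ∫ z, v z • K y z with hΦdef
    have hΦ : ContDiff ℝ 2 Φ := contDiff_integral_smul_kernel 2 hv hK hs
    have h0 : ∀ i, G.weight i = 1 → ∀ y, fderiv ℝ Φ y (G.leftField i y) = 0 := by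
      intro i hi y
      obtain ⟨hint, hder⟩ := hasFDerivAt_integral_smul_kernel (ν := volume) hv hK hs y
      rw [hder.fderiv, ContinuousLinearMap.integral_apply hint]
      set ψ' : (Fin n → ℝ) → ℝ := fun z => ψ (G.mul z (G.inv y)) with hψ'
      have hψ'd : ContDiff ℝ ((⊤ : ℕ∞) : WithTop ℕ∞) ψ' := hψ.comp (G.contDiff_mul_right _)
      have hψ'c : HasCompactSupport ψ' := hc.comp_homeomorph (G.rightTranslation (G.inv y))
      have e := hg.2 ψ' hψ'd hψ'c ⟨i, hi⟩
      simp only [Pi.zero_apply, PiLp.zero_apply, MulZeroClass.zero_mul, integral_zero,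
        neg_zero] at e
      -- As z ∘ (y ∘ w)⁻¹ = (z ∘ w⁻¹) ∘ y⁻¹, the field X_i in y acts as -X_i in z on the translated
      -- test function, against which v has zero weak derivative.
      have hpt : ∀ z, (v z • fderiv ℝ (fun x => K x z) y) (G.leftField i y) =
          -(v z * fderiv ℝ ψ' z (G.leftField i z)) := by
        intro z
        have hKz : ContDiff ℝ ((⊤ : ℕ∞) : WithTop ℕ∞) fun x => K x z :=
          hK.comp (contDiff_id.prodMk contDiff_const)
        have hcomp : ContDiff ℝ ((⊤ : ℕ∞) : WithTop ℕ∞) fun w => K (G.mul y w) z :=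
          hKz.comp (G.contDiff_mul_left y)
        rw [_root_.smul_apply,
          G.fderiv_leftField (hKz.differentiable (by simp)).differentiableAt]
        have h1 := G.hasDerivAt_mul_inv_single
          ((hψ'd.differentiable (by simp)).differentiableAt (x := z)) i
        have h2 : HasFDerivAt (fun w => K (G.mul y w) z)
            (fderiv ℝ (fun w => K (G.mul y w) z) 0) (Pi.single i (0 : ℝ)) := by
          rw [Pi.single_zero]
          exact (hcomp.differentiable (by simp)).differentiableAt.hasFDerivAt
        have h3 := h2.comp_hasDerivAt (0 : ℝ) (HomogeneousGroup.hasDerivAt_single i)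
        have h4 : (fun w => K (G.mul y w) z) ∘ (fun t : ℝ => (Pi.single i t : Fin n → ℝ)) =
            fun t : ℝ => ψ' (G.mul z (G.inv (Pi.single i t))) := by
          ext t
          simp only [hKdef, hψ', Function.comp_apply, G.inv_mul_rev, G.mul_assoc]
        rw [h4] at h3
        rw [h3.unique h1, smul_eq_mul, mul_neg]
      simp_rw [hpt]
      rw [integral_neg]
      exact neg_eq_zero.2 e
    -- First-layer derivatives vanish, hence so do those along brackets, which span every tangent
    -- space.
    have hfd : ∀ x, fderiv ℝ Φ x = 0 := by
      intro x
      have hle : (⊤ : Submodule ℝ (Fin n → ℝ)) ≤ LinearMap.ker (fderiv ℝ Φ x).toLinearMap := by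
        rw [← G.generated x, Submodule.span_le]
        rintro _ ⟨V, hV, rfl⟩
        exact hV.fderiv_apply_eq_zero hΦ h0 x
      ext1 a
      exact hle (Submodule.mem_top (x := a))
    have hconst := is_const_of_fderiv_eq_zero (hΦ.differentiable (by simp)) hfd y 0
    have e := G.integral_mul_right (fun z => v z * ψ (G.mul z (G.inv y))) y
    simp only [G.mul_inv_cancel_right] at e
    rw [e]
    simpa [hΦdef, hKdef, G.inv_zero, G.mul_zero] using hconst
  have hvy : Continuous fun z => v (G.mul z y) := hv.comp (G.contDiff_mul_right y).continuous
  have hae := ae_eq_of_integral_contDiff_smul_eq (μ := volume) hvy.locallyIntegrable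
    hv.locallyIntegrable fun ψ hψ hc => by
      simpa [mul_comm] using hkey ψ hψ hc
  have := congrFun ((hvy.ae_eq_iff_eq volume hv).1 hae) 0
  simpa [G.zero_mul] using this

end HomogeneousCarnotGroup

/-! ### Exponents and pointwise inequalities -/

/-- The exponents for Young's inequality with the terms `w ^ (α - 1) t ^ p` and
`w ^ (ω + α) t ^ χ`. -/
lemma exists_exponents {p χ ω μ : ℝ} (hp : 1 < p) (hχ₀ : 0 ≤ χ) (hχ : χ ≤ p - 1)
    (hμ₀ : 0 ≤ μ) (hμ : μ < p - χ) (hω : p - χ - 1 < ω) (D : ℝ) :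
    ∃ (m : ℕ) (a b α : ℝ), 2 ≤ m ∧ 0 ≤ a ∧ a < 1 ∧ 0 ≤ b ∧ b ≤ 1 ∧ a + b + (m : ℝ)⁻¹ = 1 ∧
      a * p + b * χ = p - 1 ∧ a * (α - 1) + b * (ω + α) = α ∧ 2 ≤ α ∧ D < m * (1 - μ * b) := by
  have hq : 0 < p - χ := by linarith
  have h1 : 0 < ω - (p - 1 - χ) := by linarith
  have h2 : 0 < p - χ - μ := by linarith
  have hω0 : 0 < ω := by linarith
  -- The first summands make m > p (so b > 0) and m > 2. The first fraction gives α ≥ 2, the second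
  -- the lower bound D.
  obtain ⟨m, hm⟩ := exists_nat_gt (p + 2 + (2 * (p - χ) + p * ω + χ) / (ω - (p - 1 - χ)) +
    |D| * (p - χ) / (p - χ - μ))
  have t1 : 0 ≤ (2 * (p - χ) + p * ω + χ) / (ω - (p - 1 - χ)) := by positivity
  have t2 : 0 ≤ |D| * (p - χ) / (p - χ - μ) := by positivity
  have hmp : p < m := by linarith
  have hm2 : (2 : ℝ) < m := by linarith
  have hm0 : (0 : ℝ) < m := by linarith
  have k1 : 2 * (p - χ) + p * ω + χ ≤ m * (ω - (p - 1 - χ)) := by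
    rw [← div_le_iff₀ h1]
    linarith
  have k2 : |D| * (p - χ) < m * (p - χ - μ) := by
    rw [← div_lt_iff₀ h2]
    linarith
  have k3 := le_abs_self D
  set c : ℝ := (m : ℝ)⁻¹ with hc
  have hc0 : 0 < c := inv_pos.2 hm0
  have hmc : m * c = 1 := mul_inv_cancel₀ hm0.ne'
  have hcp : c * p < 1 := by
    rw [← hmc, mul_comm]
    gcongr
  -- The powers of z and t determine a and b; the power of w then forces α = m(bω - a).
  set a := (p - 1 - χ * (1 - c)) / (p - χ) with ha
  set b := (1 - c * p) / (p - χ) with hb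
  have hb0 : 0 < b := div_pos (by linarith) hq
  have ha0 : 0 ≤ a := div_nonneg (by nlinarith) hq.le
  have hsum : a + b + c = 1 := by
    rw [ha, hb]
    field_simp
    ring
  have hαe : m * (b * ω - a) = (m * (ω - (p - 1 - χ)) - (p * ω + χ)) / (p - χ) := by
    have : b * ω - a = ((ω - (p - 1 - χ)) - c * (p * ω + χ)) / (p - χ) := by
      rw [ha, hb]
      field_simp
      ring
    rw [this, mul_div_assoc']
    congr 1
    linear_combination (-(p * ω + χ)) * hmc
  refine ⟨m, a, b, m * (b * ω - a), by exact_mod_cast hm2.le, ha0, by linarith, hb0.le,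
    by linarith, hsum, ?_, ?_, ?_, ?_⟩
  · rw [ha, hb]
    field_simp
    ring
  · have : a + b = 1 - c := by linarith
    linear_combination (m * (b * ω - a)) * this - (b * ω - a) * hmc
  · rw [hαe, le_div_iff₀ hq]
    linarith
  · have : m * (1 - μ * b) = (m * (p - χ - μ) + μ * p) / (p - χ) := by
      rw [hb]
      field_simp
      linear_combination (μ * p) * hmc
    rw [this, lt_div_iff₀ hq]
    nlinarith [mul_nonneg hμ₀ (by linarith : (0 : ℝ) ≤ p), mul_le_mul_of_nonneg_right k3 hq.le]

/-- Young's inequality with three terms. -/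
lemma young_three {p χ ω a b α : ℝ} {m : ℕ} (hm : 2 ≤ m) (ha : 0 ≤ a) (hb : 0 ≤ b)
    (hsum : a + b + (m : ℝ)⁻¹ = 1) (hpχ : a * p + b * χ = p - 1) (hp : 1 < p)
    (hα : a * (α - 1) + b * (ω + α) = α) (hα2 : 2 ≤ α)
    {w t z κ e : ℝ} (hw : 0 ≤ w) (ht : 0 ≤ t) (hz : 0 ≤ z) (hκ : 0 < κ) (he : 0 ≤ e) :
    e * w ^ α * z ^ (m - 1) * t ^ (p - 1) ≤ a * (w ^ (α - 1) * t ^ p * z ^ m) +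
      b * (κ * w ^ (ω + α) * t ^ χ * z ^ m) + (e * κ ^ (-b)) ^ m := by
  have hm0 : (0 : ℝ) < m := by positivity
  have hm1 : (m : ℝ)⁻¹ ≤ 1 := inv_le_one_of_one_le₀ (by exact_mod_cast (by omega : 1 ≤ m))
  have hR : 0 ≤ a * (w ^ (α - 1) * t ^ p * z ^ m) +
      b * (κ * w ^ (ω + α) * t ^ χ * z ^ m) + (e * κ ^ (-b)) ^ m := by positivity
  rcases hw.eq_or_lt with rfl | hw
  · rw [Real.zero_rpow (by linarith)]
    simpa using hR
  rcases ht.eq_or_lt with rfl | ht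
  · rw [Real.zero_rpow (by linarith : p - 1 ≠ 0)]
    simpa using hR
  rcases hz.eq_or_lt with rfl | hz
  · rw [zero_pow (by omega : m - 1 ≠ 0)]
    simpa using hR
  have hE : 0 ≤ e * κ ^ (-b) := by positivity
  -- The degenerate cases are gone, so exponents of the real powers add. The factor κ^(-b) in the
  -- third term cancels the κ^b from the second.
  have h := Real.geom_mean_le_arith_mean3_weighted ha hb (inv_nonneg.2 hm0.le)
    (by positivity : 0 ≤ w ^ (α - 1) * t ^ p * z ^ m)
    (by positivity : 0 ≤ κ * w ^ (ω + α) * t ^ χ * z ^ m) (pow_nonneg hE m) hsum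
  rw [Real.pow_rpow_inv_natCast hE (by omega)] at h
  have e1 : (w ^ (α - 1) * t ^ p * z ^ m) ^ a * (κ * w ^ (ω + α) * t ^ χ * z ^ m) ^ b =
      κ ^ b * w ^ α * z ^ (m - 1) * t ^ (p - 1) := by
    rw [← Real.rpow_natCast z m, ← Real.rpow_natCast z (m - 1)]
    rw [Real.mul_rpow (by positivity) (by positivity), Real.mul_rpow (by positivity) (by positivity),
      Real.mul_rpow (by positivity) (by positivity), Real.mul_rpow (by positivity) (by positivity),
      Real.mul_rpow (by positivity) (by positivity), ← Real.rpow_mul hw.le, ← Real.rpow_mul ht.le,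
      ← Real.rpow_mul hz.le, ← Real.rpow_mul hw.le, ← Real.rpow_mul ht.le, ← Real.rpow_mul hz.le]
    have f1 : w ^ α = w ^ ((α - 1) * a) * w ^ ((ω + α) * b) := by
      rw [← Real.rpow_add hw]
      congr 1
      linarith
    have f2 : t ^ (p - 1) = t ^ (p * a) * t ^ (χ * b) := by
      rw [← Real.rpow_add ht]
      congr 1
      linarith
    have f3 : z ^ (((m - 1 : ℕ) : ℝ)) = z ^ ((m : ℝ) * a) * z ^ ((m : ℝ) * b) := by
      rw [← Real.rpow_add hz, Nat.cast_sub (by omega)]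
      congr 1
      have := mul_inv_cancel₀ hm0.ne'
      push_cast
      linear_combination (-(m : ℝ)) * hsum + this
    rw [f1, f2, f3]
    ring
  have e2 : κ ^ b * κ ^ (-b) = 1 := by
    rw [← Real.rpow_add hκ, add_neg_cancel, Real.rpow_zero]
  have hE' : (m : ℝ)⁻¹ * (e * κ ^ (-b)) ^ m ≤ (e * κ ^ (-b)) ^ m :=
    mul_le_of_le_one_left (pow_nonneg hE m) hm1
  calc e * w ^ α * z ^ (m - 1) * t ^ (p - 1)
      = (κ ^ b * w ^ α * z ^ (m - 1) * t ^ (p - 1)) * (e * κ ^ (-b)) := by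
        linear_combination (-(e * w ^ α * z ^ (m - 1) * t ^ (p - 1))) * e2
    _ ≤ _ := by
        rw [← e1]
        linarith

/-- The pointwise lower bound for the sum of the two integrands in the weak inequality. -/
lemma integrand_lower_bound {p χ ω a b α C₀ : ℝ} {m : ℕ} (hm : 2 ≤ m) (ha : 0 ≤ a) (hb : 0 ≤ b)
    (hb1 : b ≤ 1) (hsum : a + b + (m : ℝ)⁻¹ = 1) (hpχ : a * p + b * χ = p - 1) (hp : 1 < p)
    (hα : a * (α - 1) + b * (ω + α) = α) (hα2 : 2 ≤ α) (hω : 0 ≤ ω)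
    {f T W z κ κ' U s d : ℝ} (hf : 0 ≤ f) (hf0 : T = 0 → f = 0) (hfC : f ≤ C₀ * T ^ (p - 1))
    (hT : 0 ≤ T) (hW : 0 ≤ W) (hWU : W ≤ U) (hz : 0 ≤ z) (hκ : 0 < κ) (hκ' : κ ≤ κ')
    (hd : 0 ≤ d) (hs : |s| ≤ T * d) (hC₀ : 0 ≤ C₀) :
    (1 - a) * (f * T * W ^ (α - 1) * z ^ m) - C₀ * (m * d * κ ^ (-b)) ^ m ≤
      f / T * (z ^ m * (α * W ^ (α - 1)) * T ^ 2 + W ^ α * (m * z ^ (m - 1)) * s) +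
        κ' * U ^ ω * (f / T ^ (p - 1 - χ)) * (W ^ α * z ^ m) := by
  have hE : 0 ≤ (m * d * κ ^ (-b)) ^ m := by positivity
  rcases hT.eq_or_lt with rfl | hT
  -- Here f = 0 settles the case χ = p - 1 as well, where the denominator 0 ^ 0 equals 1.
  · simp only [hf0 rfl, zero_mul, zero_div, mul_zero, add_zero]
    have := mul_nonneg hC₀ hE
    linarith
  set θ := f / T ^ (p - 1) with hθ
  have hθ0 : 0 ≤ θ := by positivity
  have hθC : θ ≤ C₀ := by rwa [hθ, div_le_iff₀ (by positivity)]
  have hfθ : f = θ * T ^ (p - 1) := by rw [hθ, div_mul_cancel₀ _ (by positivity)]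
  have hTp : T ^ p = T ^ (p - 1) * T := by
    rw [← Real.rpow_add_one hT.ne', sub_add_cancel]
  have hTχ : f / T ^ (p - 1 - χ) = θ * T ^ χ := by
    rw [Real.rpow_sub hT (p - 1) χ, hfθ]
    have : T ^ (p - 1) ≠ 0 := by positivity
    have : T ^ χ ≠ 0 := by positivity
    field_simp
  have hY := young_three (e := m * d) hm ha hb hsum hpχ hp hα hα2 hW hT.le hz hκ (by positivity)
  set A := W ^ (α - 1) * T ^ p * z ^ m with hA
  have hA0 : 0 ≤ A := by positivity
  set E := (m * d * κ ^ (-b)) ^ m with hEdef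
  set B := κ * W ^ (ω + α) * T ^ χ * z ^ m with hB
  have hB0 : 0 ≤ B := by positivity
  have h1 : (1 - a) * (f * T * W ^ (α - 1) * z ^ m) = θ * ((1 - a) * A) := by
    rw [hA, hTp, hfθ]
    ring
  have h2 : θ * (A - m * d * W ^ α * z ^ (m - 1) * T ^ (p - 1)) ≤
      f / T * (z ^ m * (α * W ^ (α - 1)) * T ^ 2 + W ^ α * (m * z ^ (m - 1)) * s) := by
    have hs' : -(T * d) ≤ s := (abs_le.1 hs).1
    have hX : 0 ≤ W ^ (α - 1) * T ^ 2 * z ^ m := by positivity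
    have hS : 0 ≤ W ^ α * (m * z ^ (m - 1)) := by positivity
    calc θ * (A - m * d * W ^ α * z ^ (m - 1) * T ^ (p - 1))
        = f / T * (W ^ (α - 1) * T ^ 2 * z ^ m + W ^ α * (m * z ^ (m - 1)) * (-(T * d))) := by
          rw [hA, hTp, hfθ]
          field_simp
          ring
      _ ≤ _ := by
          refine mul_le_mul_of_nonneg_left (add_le_add ?_ ?_) (by positivity)
          -- The factor α ≥ 1 is simply dropped.
          · nlinarith
          · exact mul_le_mul_of_nonneg_left hs' hS
  have h3 : θ * B ≤ κ' * U ^ ω * (f / T ^ (p - 1 - χ)) * (W ^ α * z ^ m) := by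
    have hU : W ^ ω ≤ U ^ ω := Real.rpow_le_rpow hW hWU hω
    have hWs : W ^ (ω + α) = W ^ ω * W ^ α := Real.rpow_add_of_nonneg hW hω (by linarith)
    rw [hTχ, hB, hWs]
    have hU0 : 0 ≤ U ^ ω := (Real.rpow_nonneg hW _).trans hU
    have hκ0 : 0 ≤ κ' := hκ.le.trans hκ'
    calc θ * (κ * (W ^ ω * W ^ α) * T ^ χ * z ^ m)
        = κ * W ^ ω * (θ * T ^ χ * (W ^ α * z ^ m)) := by ring
      _ ≤ κ' * U ^ ω * (θ * T ^ χ * (W ^ α * z ^ m)) := by gcongr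
      _ = _ := by ring
  -- Young leaves the share 1 - a of the energy, and b ≤ 1 absorbs the second term. The bound θ ≤ C₀
  -- enters only through the error.
  have h4 : θ * ((1 - a) * A) - C₀ * E ≤
      θ * (A - m * d * W ^ α * z ^ (m - 1) * T ^ (p - 1)) + θ * B := by
    have h5 : (1 - a) * A - E ≤ A - m * d * W ^ α * z ^ (m - 1) * T ^ (p - 1) + B := by
      nlinarith
    have h6 := mul_le_mul_of_nonneg_left h5 hθ0
    have h7 := mul_le_mul_of_nonneg_right hθC hE
    linarith
  linarith

/-! ### Powers of the positive part -/

/-- For α > 1 both one-sided derivatives at the kink are 0. The truncation is thus C¹, and the C¹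
chain rule applies to it. -/
lemma hasDerivAt_posPart_rpow {α : ℝ} (hα : 1 < α) (e s : ℝ) :
    HasDerivAt (fun s => max (s - e) 0 ^ α) (α * max (s - e) 0 ^ (α - 1)) s := by
  have key : ∀ y : ℝ, HasDerivAt (fun y => max y 0 ^ α) (α * max y 0 ^ (α - 1)) y := by
    intro y
    have hneg : ∀ y ≤ 0, HasDerivWithinAt (fun y : ℝ => max y 0 ^ α)
        (α * max y 0 ^ (α - 1)) (Iic 0) y := by
      intro y hy
      rw [max_eq_right hy, Real.zero_rpow (by linarith), mul_zero]
      refine (hasDerivWithinAt_const y (Iic 0) (0 : ℝ)).congr (fun x hx => ?_) ?_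
      · rw [max_eq_right (mem_Iic.1 hx), Real.zero_rpow (by linarith)]
      · rw [max_eq_right hy, Real.zero_rpow (by linarith)]
    have hpos : ∀ y ≥ 0, HasDerivWithinAt (fun y : ℝ => max y 0 ^ α)
        (α * max y 0 ^ (α - 1)) (Ici 0) y := by
      intro y hy
      rw [max_eq_left hy]
      refine (Real.hasDerivAt_rpow_const (Or.inr hα.le)).hasDerivWithinAt.congr (fun x hx => ?_) ?_
      · rw [max_eq_left (mem_Ici.1 hx)]
      · rw [max_eq_left hy]
    rcases lt_trichotomy y 0 with hy | rfl | hy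
    · exact (hneg y hy.le).hasDerivAt (Iic_mem_nhds hy)
    · have := (hneg 0 le_rfl).union (hpos 0 le_rfl)
      rwa [Iic_union_Ici, hasDerivWithinAt_univ] at this
    · exact (hpos y hy.le).hasDerivAt (Ici_mem_nhds hy)
  exact (key (s - e)).comp_sub_const s e

lemma deriv_posPart_rpow {α : ℝ} (hα : 1 < α) (e : ℝ) :
    deriv (fun s => max (s - e) 0 ^ α) = fun s => α * max (s - e) 0 ^ (α - 1) :=
  funext fun s => (hasDerivAt_posPart_rpow hα e s).deriv

lemma contDiff_posPart_rpow {α : ℝ} (hα : 1 < α) (e : ℝ) :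
    ContDiff ℝ 1 (fun s => max (s - e) 0 ^ α) := by
  rw [contDiff_one_iff_deriv, deriv_posPart_rpow hα]
  refine ⟨fun s => (hasDerivAt_posPart_rpow hα e s).differentiableAt, continuous_const.mul ?_⟩
  exact ((continuous_id.sub continuous_const).max continuous_const).rpow_const
    fun _ => Or.inr (by linarith)

/-! ### Integrability of bounded functions with compact support -/

lemma integrable_of_ae_norm_le_of_isCompact {E : Type*} [TopologicalSpace E] [MeasurableSpace E]
    [OpensMeasurableSpace E] [T2Space E] {ν : Measure E} [IsFiniteMeasureOnCompacts ν]
    {f : E → ℝ} (hf : AEStronglyMeasurable f ν) {K : Set E} (hK : IsCompact K)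
    (h0 : ∀ x, x ∉ K → f x = 0) {B : ℝ} (hB : ∀ᵐ x ∂ν, x ∈ K → ‖f x‖ ≤ B) : Integrable f ν := by
  have hi : Integrable (K.indicator fun _ => B) ν :=
    (integrable_indicator_iff hK.measurableSet).2 (integrableOn_const hK.measure_lt_top.ne)
  refine hi.mono' hf ?_
  filter_upwards [hB] with x hx
  by_cases hxK : x ∈ K
  · rw [indicator_of_mem hxK]
    exact hx hxK
  · simp [hxK, h0 x hxK]

namespace HomogeneousGroup

variable {n : ℕ} {G : HomogeneousGroup n} {r : (Fin n → ℝ) → ℝ}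

/-! ### Cutoff functions -/

lemma hgrad_pow {ζ : (Fin n → ℝ) → ℝ} (hζ : ContDiff ℝ 1 ζ) (m : ℕ) (x : Fin n → ℝ) :
    G.hgrad (fun x => ζ x ^ m) x = (m * ζ x ^ (m - 1)) • G.hgrad ζ x := by
  ext j
  rw [PiLp.smul_apply, hgrad_apply, hgrad_apply]
  have h := ((hζ.differentiable (by simp)).differentiableAt (x := x)).hasFDerivAt.pow m
  rw [h.fderiv]
  simp

/-- Cutoff functions adapted to the dilations. -/
lemma exists_cutoff (hr : G.IsHomogeneousNorm r) :
    ∃ C : ℝ, 0 < C ∧ ∀ R : ℝ, 1 ≤ R → ∃ ζ : (Fin n → ℝ) → ℝ,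
      ContDiff ℝ ((⊤ : ℕ∞) : WithTop ℕ∞) ζ ∧ HasCompactSupport ζ ∧ (∀ x, 0 ≤ ζ x) ∧
      (∀ x, ζ x ≤ 1) ∧ (∀ x, ‖x‖ ≤ R → ζ x = 1) ∧ (∀ x, ‖G.hgrad ζ x‖ ≤ C / R) ∧
      (∀ x ∈ tsupport ζ, 1 + r x ≤ C * R ∧ ‖x‖ ≤ R ^ (∑ i, G.weight i) * 2) := by
  let η : ContDiffBump (0 : Fin n → ℝ) :=
    { rIn := 1, rOut := 2, rIn_pos := one_pos, rIn_lt_rOut := one_lt_two }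
  have hη1 : ContDiff ℝ 1 η := η.contDiff
  have hsupp : tsupport η = Metric.closedBall 0 2 := η.tsupport_eq
  have hηc : HasCompactSupport (G.hgrad η) := by
    refine HasCompactSupport.intro (K := tsupport η) η.hasCompactSupport fun x hx => ?_
    have hx' : fderiv ℝ η x = 0 := by
      by_contra h
      exact hx (support_fderiv_subset ℝ h)
    ext j
    simp [hgrad_apply, hx']
  obtain ⟨A, hA⟩ := (continuous_hgrad (G := G) hη1).bounded_above_of_compact_support hηc
  obtain ⟨B, hB⟩ := (isCompact_closedBall (0 : Fin n → ℝ) 2).exists_bound_of_continuousOn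
    hr.continuous.continuousOn
  have hA0 : 0 ≤ A := (norm_nonneg _).trans (hA 0)
  have hB0 : 0 ≤ B := (norm_nonneg _).trans (hB 0 (by simp))
  -- The cutoff is one fixed bump composed with δ_{1/R}. `A` bounds its gradient and `B` bounds r on
  -- its support; the extra 1 absorbs the 1 in 1 + r, as R ≥ 1.
  refine ⟨A + B + 1, by positivity, fun R hR => ?_⟩
  have hR0 : 0 < R := by linarith
  have hRi : 0 < R⁻¹ := inv_pos.2 hR0
  have hcd : ContDiff ℝ ((⊤ : ℕ∞) : WithTop ℕ∞) (G.dilation R⁻¹) := (G.dilationL R⁻¹).contDiff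
  have hback : ∀ x, G.dilation R (G.dilation R⁻¹ x) = x := fun x => by
    rw [G.dilation_dilation, mul_inv_cancel₀ hR0.ne', G.dilation_one]
  have hts : ∀ x ∈ tsupport (fun x => η (G.dilation R⁻¹ x)), ‖G.dilation R⁻¹ x‖ ≤ 2 := by
    intro x hx
    have h := tsupport_comp_subset_preimage η hcd.continuous hx
    rw [mem_preimage, hsupp, mem_closedBall_zero_iff] at h
    exact h
  refine ⟨fun x => η (G.dilation R⁻¹ x), η.contDiff.comp hcd, ?_, fun x => η.nonneg,
    fun x => η.le_one, fun x hx => ?_, fun x => ?_, fun x hx => ⟨?_, ?_⟩⟩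
  · refine HasCompactSupport.of_support_subset_isCompact
      ((isCompact_closedBall (0 : Fin n → ℝ) 2).image (G.continuous_dilation R)) fun x hx => ?_
    exact ⟨G.dilation R⁻¹ x, mem_closedBall_zero_iff.2 (hts x (subset_tsupport _ hx)), hback x⟩
  · refine η.one_of_mem_closedBall (mem_closedBall_zero_iff.2 ?_)
    refine (G.norm_dilation_le hRi.le (inv_le_one_of_one_le₀ hR) x).trans ?_
    rwa [inv_mul_le_iff₀ hR0, show η.rIn = 1 from rfl, _root_.mul_one]
  · rw [hgrad_comp_dilation hη1 hRi, norm_smul, Real.norm_of_nonneg hRi.le, div_eq_inv_mul]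
    gcongr
    exact (hA _).trans (by linarith)
  · have h := hB _ (mem_closedBall_zero_iff.2 (hts x hx))
    rw [hr.dilation _ hRi, Real.norm_of_nonneg (mul_nonneg hRi.le (hr.nonneg x)),
      inv_mul_le_iff₀ hR0] at h
    nlinarith
  · conv_lhs => rw [← hback x]
    refine (G.norm_dilation_le_pow hR _).trans ?_
    gcongr
    exact hts x hx

end HomogeneousGroup

/-! ### Consequences of weak coercivity -/

lemma WeaklyCoercive.nonneg {φ : ℝ → ℝ} {p : ℝ} (hφ : WeaklyCoercive φ p) {t : ℝ} (ht : 0 ≤ t) :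
    0 ≤ φ t := by
  rcases ht.eq_or_lt with rfl | ht
  · exact hφ.zero.ge
  · exact (hφ.pos t ht).le

lemma WeaklyCoercive.exists_le {φ : ℝ → ℝ} {p : ℝ} (hp : 1 < p) (hφ : WeaklyCoercive φ p) :
    ∃ C : ℝ, 0 < C ∧ ∀ t, 0 ≤ t → φ t ≤ C * t ^ (p - 1) := by
  obtain ⟨C, hC, h⟩ := hφ.bound
  refine ⟨C, hC, fun t ht => ?_⟩
  rcases ht.eq_or_lt with rfl | ht
  · rw [hφ.zero, Real.zero_rpow (by linarith), mul_zero]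
  · exact h t ht

/-- Continuity of φ is known only on [0, ∞), so φ is replaced by its continuous extension t ↦ φ(max
t 0). -/
lemma WeaklyCoercive.aestronglyMeasurable_comp_norm {φ : ℝ → ℝ} {p : ℝ}
    (hφ : WeaklyCoercive φ p) {X F : Type*} [MeasurableSpace X] [NormedAddCommGroup F]
    {ν : Measure X} {g : X → F} (hg : AEStronglyMeasurable g ν) :
    AEStronglyMeasurable (fun x => φ ‖g x‖) ν := by
  have hc : Continuous fun t : ℝ => φ (max t 0) :=
    hφ.continuousOn.comp_continuous (continuous_id.max continuous_const) fun t => le_max_right t 0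
  refine (hc.comp_aestronglyMeasurable hg.norm).congr (Eventually.of_forall fun x => ?_)
  simp

/-! ### Energy decay and vanishing of the gradient -/

namespace HomogeneousGroup

variable {n : ℕ} {G : HomogeneousGroup n} {r : (Fin n → ℝ) → ℝ}

/-- The energy estimate on the region where the cutoff function equals one. -/
lemma exists_energy_le (hr : G.IsHomogeneousNorm r) {φ : ℝ → ℝ} {p : ℝ} (hp : 1 < p)
    (hφ : WeaklyCoercive φ p) {μ ω χ : ℝ} (hχ₀ : 0 ≤ χ) (hχ : χ ≤ p - 1) (hμ : μ < p - χ)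
    (hω : p - χ - 1 < ω) {γ K : ℝ} (hγ : 0 ≤ γ) (hK : 0 < K) {u : (Fin n → ℝ) → ℝ}
    (hu : G.IsLocLip r u) {g : (Fin n → ℝ) → EuclideanSpace ℝ G.Horizontal}
    (hg : G.IsWeakHorizontalGradient u g)
    (hsol : ∀ ψ : (Fin n → ℝ) → ℝ, G.IsLipOn r ψ univ → HasCompactSupport ψ →
      tsupport ψ ⊆ {x | γ < u x} → (∀ x, 0 ≤ ψ x) →
      ∀ h : (Fin n → ℝ) → EuclideanSpace ℝ G.Horizontal, G.IsWeakHorizontalGradient ψ h →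
        ∫ x in {x | γ < u x}, φ ‖g x‖ / ‖g x‖ * inner ℝ (g x) (h x) ≤
          - ∫ x in {x | γ < u x}, K * (1 + r x) ^ (-μ) * u x ^ ω *
            (φ ‖g x‖ / ‖g x‖ ^ (p - 1 - χ)) * ψ x)
    {ε : ℝ} (hε : 0 < ε) :
    ∃ α s C : ℝ, 2 ≤ α ∧ 0 < s ∧ ∀ R : ℝ, 1 ≤ R →
      ∫ x in {x | γ < u x} ∩ Metric.closedBall 0 R,
        φ ‖g x‖ * ‖g x‖ * max (u x - (γ + ε)) 0 ^ (α - 1) ≤ C * R ^ (-s) := by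
  obtain ⟨C₀, hC₀, hφC⟩ := hφ.exists_le hp
  obtain ⟨C₁, hC₁, hcut⟩ := exists_cutoff hr
  set N : ℕ := ∑ i, G.weight i with hN
  -- Since 1 + r ≥ 1, replacing μ by its positive part only weakens the coefficient, and the result
  -- is still below p - χ.
  set μ' := max μ 0 with hμ'
  have hμ'0 : 0 ≤ μ' := le_max_right _ _
  have hω0 : 0 < ω := by linarith
  -- The volume of the cutoff's support is bounded crudely by a multiple of R^(N n); since m is
  -- free, no sharper dimension is needed.
  obtain ⟨m, a, b, α, hm, ha, ha1, hb, hb1, hsum, hpχ, hαe, hα2, hD⟩ :=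
    exists_exponents hp hχ₀ hχ hμ'0 (max_lt hμ (by linarith)) hω (N * n)
  have ha1' : 0 < 1 - a := by linarith
  set k := K * C₁ ^ (-μ') with hk
  have hk0 : 0 < k := by positivity
  have hcu := hu.continuous hr
  set Ω : Set (Fin n → ℝ) := {x | γ < u x} with hΩ
  have hΩo : IsOpen Ω := isOpen_lt continuous_const hcu
  set W : (Fin n → ℝ) → ℝ := fun x => max (u x - (γ + ε)) 0 with hW
  have hWc : Continuous W := (hcu.sub continuous_const).max continuous_const
  have hW0 : ∀ x, 0 ≤ W x := fun x => le_max_right _ _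
  have hgm : AEStronglyMeasurable g := hg.1.aestronglyMeasurable
  have hφm : AEStronglyMeasurable fun x => φ ‖g x‖ := hφ.aestronglyMeasurable_comp_norm hgm
  have hφ0 : ∀ x, 0 ≤ φ ‖g x‖ := fun x => hφ.nonneg (norm_nonneg _)
  refine ⟨α, m * (1 - μ' * b) - N * n, (1 - a)⁻¹ * (C₀ * (m * C₁ * k ^ (-b)) ^ m * 4 ^ n),
    hα2, by linarith, fun R hR => ?_⟩
  have hR0 : 0 < R := by linarith
  obtain ⟨ζ, hζ, hζc, hζ0, hζ1, hζR, hζg, hζs⟩ := hcut R hR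
  have hζ1' : ContDiff ℝ 1 ζ := hζ.of_le (by exact_mod_cast le_top)
  set S := tsupport ζ with hS
  have hSc : IsCompact S := hζc
  have hζS : ∀ x, x ∉ S → ζ x = 0 := fun x hx => image_eq_zero_of_notMem_tsupport hx
  set F : ℝ → ℝ := fun t => max (t - (γ + ε)) 0 ^ α with hF
  have hFcd : ContDiff ℝ 1 F := contDiff_posPart_rpow (by linarith) _
  set ψ : (Fin n → ℝ) → ℝ := fun x => F (u x) * ζ x ^ m with hψ
  set h : (Fin n → ℝ) → EuclideanSpace ℝ G.Horizontal := fun x =>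
    ζ x ^ m • (deriv F (u x) • g x) + F (u x) • G.hgrad (fun x => ζ x ^ m) x with hh
  have hFu := hu.comp hr hFcd
  have hψh : G.IsWeakHorizontalGradient ψ h :=
    (hg.comp hr hu hFcd).mul_contDiff (hFu.continuous hr) (hζ.pow m)
  have hψlip : G.IsLocLip r ψ := hFu.mul hr (IsLocLip.of_contDiff hr (hζ1'.pow m))
  have hψS : ∀ x, x ∉ S → ψ x = 0 := fun x hx => by
    simp [hψ, hζS x hx, zero_pow (by omega : m ≠ 0)]
  have hhS : ∀ x, x ∉ S → h x = 0 := fun x hx => by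
    simp [hh, hgrad_pow hζ1', hζS x hx, zero_pow (by omega : m ≠ 0),
      zero_pow (by omega : m - 1 ≠ 0)]
  have hψc : HasCompactSupport ψ := HasCompactSupport.intro hSc hψS
  have hψΩ : tsupport ψ ⊆ Ω := by
    -- The gap ε keeps the closed support of ψ inside the open set where u > γ.
    have hcl : IsClosed {x | γ + ε ≤ u x} := isClosed_le continuous_const hcu
    refine (closure_minimal (fun x hx => ?_) hcl).trans fun x (hx : γ + ε ≤ u x) => ?_
    · by_contra hxW
      have hx' : u x < γ + ε := not_le.1 hxW
      refine hx ?_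
      simp only [hψ, hF]
      rw [max_eq_right (by linarith), Real.zero_rpow (by linarith), MulZeroClass.zero_mul]
    · show γ < u x
      linarith
  have hψ0 : ∀ x, 0 ≤ ψ x := fun x =>
    mul_nonneg (Real.rpow_nonneg (le_max_right _ _) _) (pow_nonneg (hζ0 x) m)
  have hineq := hsol ψ (hψlip.isLipOn_univ hr hψc) hψc hψΩ hψ0 h hψh
  obtain ⟨M, hM0, hM⟩ := hg.exists_ae_norm_le hr hu hSc
  obtain ⟨M', hM'0, hM'⟩ := hψh.exists_ae_norm_le hr hψlip hSc
  set I₁ : (Fin n → ℝ) → ℝ := fun x => φ ‖g x‖ / ‖g x‖ * inner ℝ (g x) (h x) with hI₁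
  set I₂ : (Fin n → ℝ) → ℝ := fun x => K * (1 + r x) ^ (-μ) * u x ^ ω *
    (φ ‖g x‖ / ‖g x‖ ^ (p - 1 - χ)) * ψ x with hI₂
  -- Integrability is needed to add the two sides of `hineq`, since a Bochner integral is 0 by
  -- default.
  have hi₁ : Integrable I₁ := by
    refine integrable_of_ae_norm_le_of_isCompact (K := S) (B := C₀ * M ^ (p - 1) * M') ?_ hSc
      (fun x hx => by simp [hI₁, hhS x hx]) ?_
    · exact ((hφm.aemeasurable.div hgm.norm.aemeasurable).aestronglyMeasurable).mul
        (hgm.inner hψh.1.aestronglyMeasurable)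
    · filter_upwards [hM, hM'] with x h1 h2 hx
      have h1 := h1 hx
      have h2 := h2 hx
      have h3 := abs_real_inner_le_norm (g x) (h x)
      have h4 : φ ‖g x‖ ≤ C₀ * M ^ (p - 1) := (hφC _ (norm_nonneg _)).trans (by gcongr)
      have h5 := hφ0 x
      rw [hI₁, norm_mul, Real.norm_eq_abs, Real.norm_eq_abs, abs_of_nonneg (by positivity)]
      calc φ ‖g x‖ / ‖g x‖ * |inner ℝ (g x) (h x)|
          ≤ φ ‖g x‖ / ‖g x‖ * (‖g x‖ * ‖h x‖) := by gcongr
        _ = (φ ‖g x‖ / ‖g x‖ * ‖g x‖) * ‖h x‖ := by ring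
        _ ≤ φ ‖g x‖ * ‖h x‖ := by
            gcongr
            rcases eq_or_ne ‖g x‖ 0 with h0 | h0
            · rw [h0] at h5 ⊢
              rwa [MulZeroClass.mul_zero]
            · rw [div_mul_cancel₀ _ h0]
        _ ≤ _ := by gcongr
  have hcoef : Continuous fun x => K * (1 + r x) ^ (-μ) * u x ^ ω * ψ x := by
    refine ((continuous_const.mul ?_).mul (hcu.rpow_const fun x => Or.inr hω0.le)).mul
      (hψlip.continuous hr)
    refine (continuous_const.add hr.continuous).rpow_const fun x => Or.inl ?_
    have := hr.nonneg x
    exact (by linarith : 0 < 1 + r x).ne'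
  obtain ⟨B, hB⟩ := hSc.exists_bound_of_continuousOn hcoef.continuousOn
  have hi₂ : Integrable I₂ := by
    refine integrable_of_ae_norm_le_of_isCompact (K := S) (B := B * (C₀ * M ^ χ)) ?_ hSc
      (fun x hx => by simp [hI₂, hψS x hx]) ?_
    · have hm2 : AEStronglyMeasurable fun x => φ ‖g x‖ / ‖g x‖ ^ (p - 1 - χ) :=
        (hφm.aemeasurable.div (hgm.norm.aemeasurable.pow_const _)).aestronglyMeasurable
      refine (hcoef.aestronglyMeasurable.mul hm2).congr (Eventually.of_forall fun x => ?_)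
      simp only [hI₂, Pi.mul_apply]
      ring
    · filter_upwards [hM] with x h1 hx
      have h1 := h1 hx
      have h2 := hB x hx
      have h5 := hφ0 x
      have h3 : φ ‖g x‖ / ‖g x‖ ^ (p - 1 - χ) ≤ C₀ * M ^ χ := by
        rcases (norm_nonneg (g x)).eq_or_lt with h0 | h0
        · rw [← h0, hφ.zero, zero_div]
          positivity
        · rw [div_le_iff₀ (by positivity)]
          calc φ ‖g x‖ ≤ C₀ * ‖g x‖ ^ (p - 1) := hφC _ h0.le
            _ = C₀ * ‖g x‖ ^ χ * ‖g x‖ ^ (p - 1 - χ) := by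
                rw [_root_.mul_assoc, ← Real.rpow_add h0]
                congr 2
                ring
            _ ≤ _ := by gcongr
      have e : I₂ x = (K * (1 + r x) ^ (-μ) * u x ^ ω * ψ x) *
          (φ ‖g x‖ / ‖g x‖ ^ (p - 1 - χ)) := by
        simp only [hI₂]
        ring
      rw [e, norm_mul, Real.norm_of_nonneg (by positivity :
        0 ≤ φ ‖g x‖ / ‖g x‖ ^ (p - 1 - χ))]
      exact mul_le_mul h2 h3 (by positivity) ((norm_nonneg _).trans h2)
  set E := (m * (C₁ / R) * (k * R ^ (-μ')) ^ (-b)) ^ m with hE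
  have hE0 : 0 ≤ E := by positivity
  set J : (Fin n → ℝ) → ℝ := fun x => φ ‖g x‖ * ‖g x‖ * W x ^ (α - 1) * ζ x ^ m with hJ
  have hJ0 : ∀ x, 0 ≤ J x := fun x => by
    have := hφ0 x
    have := hW0 x
    have := hζ0 x
    positivity
  have hbd : ∀ x ∈ Ω, (1 - a) * J x - S.indicator (fun _ => C₀ * E) x ≤ I₁ x + I₂ x := by
    intro x hx
    by_cases hxS : x ∈ S
    · rw [indicator_of_mem hxS]
      have hs := hζs x hxS
      have hrx := hr.nonneg x
      have hux : γ < u x := hx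
      have hκ' : k * R ^ (-μ') ≤ K * (1 + r x) ^ (-μ) := by
        rw [hk, _root_.mul_assoc, ← Real.mul_rpow hC₁.le hR0.le]
        gcongr
        calc (C₁ * R) ^ (-μ') ≤ (1 + r x) ^ (-μ') :=
              Real.rpow_le_rpow_of_nonpos (by linarith) hs.1 (by linarith)
          _ ≤ (1 + r x) ^ (-μ) :=
              Real.rpow_le_rpow_of_exponent_le (by linarith) (neg_le_neg (le_max_left _ _))
      have hin : |inner ℝ (g x) (G.hgrad ζ x)| ≤ ‖g x‖ * (C₁ / R) :=
        (abs_real_inner_le_norm _ _).trans (by gcongr; exact hζg x)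
      have key := integrand_lower_bound hm ha hb hb1 hsum hpχ hp hαe hα2 hω0.le (hφ0 x)
        (fun h0 => by rw [h0, hφ.zero]) (hφC _ (norm_nonneg (g x))) (norm_nonneg (g x)) (hW0 x)
        (show W x ≤ u x from max_le (by linarith) (by linarith)) (hζ0 x)
        (by positivity : 0 < k * R ^ (-μ')) hκ' (by positivity : 0 ≤ C₁ / R) hin hC₀.le
      refine key.trans (le_of_eq ?_)
      have hF' : deriv F (u x) = α * W x ^ (α - 1) := by
        rw [hF, deriv_posPart_rpow (by linarith)]
      simp only [hI₁, hI₂, hh, hψ, hgrad_pow hζ1', inner_add_right, inner_smul_right,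
        real_inner_self_eq_norm_sq, hF']
      rw [show F (u x) = W x ^ α from rfl]
      ring
    · rw [indicator_of_notMem hxS]
      have hz := hζS x hxS
      simp [hI₁, hI₂, hJ, hψS x hxS, hhS x hxS, hz, zero_pow (by omega : m ≠ 0)]
  have hind : Integrable (S.indicator fun _ => C₀ * E) :=
    (integrable_indicator_iff hSc.measurableSet).2 (integrableOn_const hSc.measure_lt_top.ne)
  have hvol : volume.real S ≤ (4 * R ^ N) ^ n := by
    have hsub : S ⊆ Metric.closedBall 0 (R ^ N * 2) := fun x hx =>
      mem_closedBall_zero_iff.2 (hζs x hx).2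
    have hball : volume.real (Metric.closedBall (0 : Fin n → ℝ) (R ^ N * 2)) = (4 * R ^ N) ^ n := by
      rw [measureReal_def, Real.volume_pi_closedBall _ (by positivity),
        ENNReal.toReal_ofReal (by positivity), Fintype.card_fin]
      congr 1
      ring
    rw [← hball]
    exact measureReal_mono hsub (isCompact_closedBall _ _).measure_lt_top.ne
  have hE' : C₀ * E * (4 * R ^ N) ^ n =
      C₀ * (m * C₁ * k ^ (-b)) ^ m * 4 ^ n * R ^ (-(m * (1 - μ' * b) - N * n)) := by
    -- Power count: each of the m factors contributes R^(-1) from the gradient and R^(μ'b) from the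
    -- coefficient; the volume contributes R^(N n).
    have h1 : R ^ (-(m * (1 - μ' * b) - N * n)) = (R⁻¹ * R ^ (μ' * b)) ^ m * (R ^ N) ^ n := by
      rw [← Real.rpow_neg_one R, ← Real.rpow_add hR0, ← Real.rpow_mul_natCast hR0.le, ← pow_mul,
        ← Real.rpow_natCast R (N * n), ← Real.rpow_add hR0]
      congr 1
      push_cast
      ring
    rw [h1, hE, Real.mul_rpow hk0.le (by positivity), ← Real.rpow_mul hR0.le, neg_mul_neg]
    rw [div_eq_mul_inv]
    simp only [mul_pow]
    ring
  have hmain : (1 - a) * ∫ x in Ω, J x ≤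
      C₀ * (m * C₁ * k ^ (-b)) ^ m * 4 ^ n * R ^ (-(m * (1 - μ' * b) - N * n)) := by
    rw [← hE', ← integral_const_mul]
    calc ∫ x in Ω, (1 - a) * J x
        ≤ ∫ x in Ω, (I₁ x + I₂ x + S.indicator (fun _ => C₀ * E) x) := by
          refine integral_mono_of_nonneg
            (Eventually.of_forall fun x => mul_nonneg ha1'.le (hJ0 x))
            ((hi₁.add hi₂).add hind).integrableOn ?_
          filter_upwards [ae_restrict_mem hΩo.measurableSet] with x hx
          have := hbd x hx
          linarith
      _ = (∫ x in Ω, I₁ x) + (∫ x in Ω, I₂ x) + ∫ x in Ω, S.indicator (fun _ => C₀ * E) x := by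
          rw [← integral_add hi₁.integrableOn hi₂.integrableOn]
          exact integral_add (hi₁.add hi₂).integrableOn hind.integrableOn
      _ ≤ 0 + ∫ x, S.indicator (fun _ => C₀ * E) x := by
          refine add_le_add (by linarith) (setIntegral_le_integral hind
            (Eventually.of_forall fun x => indicator_nonneg (fun _ _ => by positivity) x))
      _ = C₀ * E * volume.real S := by
          rw [integral_indicator hSc.measurableSet, setIntegral_const, smul_eq_mul]
          ring
      _ ≤ _ := by gcongr
  have hJi : Integrable J := by
    have hc : Continuous fun x => W x ^ (α - 1) * ζ x ^ m :=
      (hWc.rpow_const fun x => Or.inr (by linarith)).mul (hζ.continuous.pow m)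
    obtain ⟨B', hB'⟩ := hSc.exists_bound_of_continuousOn hc.continuousOn
    refine integrable_of_ae_norm_le_of_isCompact (K := S) (B := C₀ * M ^ (p - 1) * M * B') ?_ hSc
      (fun x hx => by simp [hJ, hζS x hx, zero_pow (by omega : m ≠ 0)]) ?_
    · refine ((hφm.mul hgm.norm).mul hc.aestronglyMeasurable).congr
        (Eventually.of_forall fun x => ?_)
      simp only [hJ, Pi.mul_apply]
      ring
    · filter_upwards [hM] with x h1 hx
      have h1 := h1 hx
      have h2 := hB' x hx
      have h5 := hφ0 x
      have h4 : φ ‖g x‖ ≤ C₀ * M ^ (p - 1) := (hφC _ (norm_nonneg _)).trans (by gcongr)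
      have e : J x = φ ‖g x‖ * ‖g x‖ * (W x ^ (α - 1) * ζ x ^ m) := by
        simp only [hJ]
        ring
      rw [e, norm_mul, Real.norm_of_nonneg (by positivity)]
      gcongr
  rw [_root_.mul_assoc, le_inv_mul_iff₀ ha1']
  refine le_trans ?_ hmain
  refine mul_le_mul_of_nonneg_left ?_ ha1'.le
  calc ∫ x in Ω ∩ Metric.closedBall 0 R, φ ‖g x‖ * ‖g x‖ * max (u x - (γ + ε)) 0 ^ (α - 1)
      = ∫ x in Ω ∩ Metric.closedBall 0 R, J x := by
        refine setIntegral_congr_fun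
          (hΩo.measurableSet.inter Metric.isClosed_closedBall.measurableSet) fun x hx => ?_
        simp only [hJ, hW]
        rw [hζR x (mem_closedBall_zero_iff.1 hx.2), one_pow, _root_.mul_one]
    _ ≤ _ := setIntegral_mono_set hJi.integrableOn (Eventually.of_forall hJ0)
        (Eventually.of_forall fun x hx => hx.1)

end HomogeneousGroup

/-- The weak gradient of a solution vanishes where `u > γ + ε`. -/
lemma HomogeneousGroup.ae_eq_zero_of_energy_le {n : ℕ} {G : HomogeneousGroup n}
    {r : (Fin n → ℝ) → ℝ} (hr : G.IsHomogeneousNorm r) {φ : ℝ → ℝ} {p : ℝ} (hp : 1 < p)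
    (hφ : WeaklyCoercive φ p) {γ ε : ℝ} (hε : 0 < ε) {u : (Fin n → ℝ) → ℝ}
    (hu : G.IsLocLip r u) {g : (Fin n → ℝ) → EuclideanSpace ℝ G.Horizontal}
    (hg : G.IsWeakHorizontalGradient u g) {α s C : ℝ} (hα : 2 ≤ α) (hs : 0 < s)
    (hE : ∀ R : ℝ, 1 ≤ R → ∫ x in {x | γ < u x} ∩ Metric.closedBall 0 R,
        φ ‖g x‖ * ‖g x‖ * max (u x - (γ + ε)) 0 ^ (α - 1) ≤ C * R ^ (-s)) :
    ∀ᵐ x, γ + ε < u x → g x = 0 := by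
  obtain ⟨C₀, hC₀, hφC⟩ := hφ.exists_le hp
  have hcu := hu.continuous hr
  set Ω : Set (Fin n → ℝ) := {x | γ < u x} with hΩ
  have hΩo : IsOpen Ω := isOpen_lt continuous_const hcu
  set H : (Fin n → ℝ) → ℝ := fun x => φ ‖g x‖ * ‖g x‖ * max (u x - (γ + ε)) 0 ^ (α - 1) with hH
  have hφ0 : ∀ x, 0 ≤ φ ‖g x‖ := fun x => hφ.nonneg (norm_nonneg _)
  have hH0 : ∀ x, 0 ≤ H x := fun x =>
    mul_nonneg (mul_nonneg (hφ0 x) (norm_nonneg _)) (Real.rpow_nonneg (le_max_right _ _) _)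
  have hgm : AEStronglyMeasurable g := hg.1.aestronglyMeasurable
  have hHi : ∀ R : ℝ, IntegrableOn H (Metric.closedBall 0 R) := by
    intro R
    have hKc := isCompact_closedBall (0 : Fin n → ℝ) R
    obtain ⟨M, hM0, hM⟩ := hg.exists_ae_norm_le hr hu hKc
    have hc : Continuous fun x => max (u x - (γ + ε)) 0 ^ (α - 1) :=
      ((hcu.sub continuous_const).max continuous_const).rpow_const
        fun x => Or.inr (by linarith)
    obtain ⟨B, hB⟩ := hKc.exists_bound_of_continuousOn hc.continuousOn
    refine Measure.integrableOn_of_bounded (M := C₀ * M ^ (p - 1) * M * B)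
      hKc.measure_lt_top.ne
      (((hφ.aestronglyMeasurable_comp_norm hgm).mul hgm.norm).mul hc.aestronglyMeasurable) ?_
    rw [ae_restrict_iff' hKc.measurableSet]
    filter_upwards [hM] with x h1 hx
    have h1 := h1 hx
    have h2 := hB x hx
    have h5 := hφ0 x
    have h4 : φ ‖g x‖ ≤ C₀ * M ^ (p - 1) := (hφC _ (norm_nonneg _)).trans (by gcongr)
    rw [hH, norm_mul, Real.norm_of_nonneg (by positivity : 0 ≤ φ ‖g x‖ * ‖g x‖)]
    gcongr
  have hzero : ∀ k : ℕ, ∀ᵐ x, x ∈ Ω ∩ Metric.closedBall 0 (k : ℝ) → H x = 0 := by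
    intro k
    have hmeas : MeasurableSet (Ω ∩ Metric.closedBall 0 (k : ℝ)) :=
      hΩo.measurableSet.inter Metric.isClosed_closedBall.measurableSet
    have hlim : Tendsto (fun R : ℝ => C * R ^ (-s)) atTop (𝓝 0) := by
      simpa using (tendsto_rpow_neg_atTop hs).const_mul C
    -- The energy on a fixed ball is at most that on every larger ball, which tends to 0.
    have hle : ∫ x in Ω ∩ Metric.closedBall 0 (k : ℝ), H x ≤ 0 := by
      refine ge_of_tendsto hlim ?_
      filter_upwards [eventually_ge_atTop (1 : ℝ), eventually_ge_atTop (k : ℝ)] with R h1 h2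
      refine le_trans ?_ (hE R h1)
      exact setIntegral_mono_set ((hHi R).mono_set inter_subset_right)
        (Eventually.of_forall hH0)
        (Eventually.of_forall fun x hx => ⟨hx.1, Metric.closedBall_subset_closedBall h2 hx.2⟩)
    have heq := le_antisymm hle (integral_nonneg hH0)
    rw [integral_eq_zero_iff_of_nonneg hH0 ((hHi k).mono_set inter_subset_right)] at heq
    exact (ae_restrict_iff' hmeas).1 heq
  filter_upwards [ae_all_iff.2 hzero] with x hx hux
  obtain ⟨k, hk⟩ := exists_nat_ge ‖x‖
  have h0 := hx k ⟨show γ < u x by linarith, mem_closedBall_zero_iff.2 hk⟩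
  have hW : 0 < max (u x - (γ + ε)) 0 ^ (α - 1) :=
    Real.rpow_pos_of_pos (lt_max_of_lt_left (by linarith)) _
  by_contra hne
  have hpos : 0 < ‖g x‖ := norm_pos_iff.2 hne
  exact absurd h0 (mul_pos (mul_pos (hφ.pos _ hpos) hpos) hW).ne'

/-! ### Conclusion: the solution is constant -/

theorem mainTheorem4 {n : ℕ} (G : HomogeneousCarnotGroup n)
    (r : (Fin n → ℝ) → ℝ) (hr : G.IsHomogeneousNorm r)
    (φ : ℝ → ℝ) (p : ℝ) (hp : 1 < p) (hφ : WeaklyCoercive φ p)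
    (μ ω χ : ℝ) (hχ₀ : 0 ≤ χ) (hχ : χ ≤ p - 1) (hμ : μ < p - χ) (hω : p - χ - 1 < ω)
    (γ K : ℝ) (hγ : 0 ≤ γ) (hK : 0 < K) :
    ¬ ∃ u : (Fin n → ℝ) → ℝ,
      G.IsLocLip r u ∧ (¬ ∃ c : ℝ, ∀ x, u x = c) ∧ {x | γ < u x}.Nonempty ∧
        G.IsWeakSolutionOn r φ {x | γ < u x}
          (fun x => K * (1 + r x) ^ (-μ)) (fun s => s ^ ω)
          (fun t => φ t / t ^ (p - 1 - χ)) u := by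
  rintro ⟨u, hu, hnc, ⟨x₀, hx₀⟩, g, hg, hsol⟩
  have hx₀' : γ < u x₀ := hx₀
  have hε : 0 < (u x₀ - γ) / 2 := by linarith
  -- The midpoint of γ and u(x₀): above γ, as the estimate requires, yet below a value of u.
  set e := γ + (u x₀ - γ) / 2 with he
  obtain ⟨α, s, C, hα, hs, hE⟩ := HomogeneousGroup.exists_energy_le hr hp hφ hχ₀ hχ hμ hω hγ hK
    hu hg hsol hε
  have hg0 := HomogeneousGroup.ae_eq_zero_of_energy_le hr hp hφ hε hu hg hα hs hE
  have hα1 : 1 < α := by linarith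
  have hF := contDiff_posPart_rpow hα1 e
  have hFg := hg.comp hr hu hF
  have hFg0 : G.IsWeakHorizontalGradient (fun x => max (u x - e) 0 ^ α) 0 := by
    refine ⟨locallyIntegrable_zero, fun ψ hψ hc j => ?_⟩
    rw [hFg.2 ψ hψ hc j]
    congr 1
    refine integral_congr_ae ?_
    filter_upwards [hg0] with x hx
    rw [deriv_posPart_rpow hα1]
    rcases lt_or_ge e (u x) with h | h
    · simp [hx h]
    · simp [max_eq_right (sub_nonpos.2 h), Real.zero_rpow (by linarith : α - 1 ≠ 0)]
  have hconst := fun y => HomogeneousCarnotGroup.eq_of_isWeakHorizontalGradient_zero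
    ((hu.comp hr hF).continuous hr) hFg0 y
  have hmax : ∀ y, max (u y - e) 0 = max (u x₀ - e) 0 := fun y =>
    (Real.rpow_left_inj (le_max_right _ _) (le_max_right _ _) (by linarith)).1
      ((hconst y).trans (hconst x₀).symm)
  -- The truncation is a positive constant, so u > e everywhere and it can be undone.
  refine hnc ⟨u x₀, fun y => ?_⟩
  have hpos : 0 < u x₀ - e := by linarith
  have h := hmax y
  rw [max_eq_left hpos.le] at h
  rcases max_cases (u y - e) 0 with h' | h' <;> linarith
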